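/- Let $1\le m\le K-1$ and let $X^k=(X^k_n)_{n\ge1}$, $k\in[K]=\{1,\dots,K\}$, be independent streams of observations. For each $k$ let $\mu^k$ be a $\sigma$-finite measure and $f_0^k,f_1^k$ probability densities with respect to $\mu^k$ whose laws are mutually absolutely continuous; under hypothesis $i\in\{0,1\}$ ($0$ = noise, $1$ = signal) the observations $X^k_1,X^k_2,\dots$ are i.i.d. with density $f_i^k$. Assume that for every $k$ $$D_0^k=\int \log\Big(\frac{f_0^k}{f_1^k}\Big) f_0^k\,d\mu^k,\qquad D_1^k=\int \log\Big(\frac{f_1^k}{f_0^k}\Big) f_1^k\,d\mu^k$$ are positive and finite and that $\int (\log (f_0^k/f_1^k))^2 f_i^k\,d\mu^k<\infty$ for $i=0,1$. For $\mathcal A\subset[K]$ let $\mathsf P_{\mathcal A}$ (with expectation $\mathsf E_{\mathcal A}$) be the law under which the streams are independent and stream $k$ follows hypothesis $1$ if $k\in\mathcal A$ and hypothesis $0$ if $k\notin\mathcal A$. Put $\mathcal P_m=\{\mathcal A\subset[K]:|\mathcal A|=m\}$, $\eta_1^{\mathcal A}=\min_{k\in\mathcal A}D_1^k$ and $\eta_0^{\mathcal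 A}=\min_{j\notin\mathcal A}D_0^j$. A sequential test is a pair $(T,d)$ of a stopping time $T\ge1$ (possibly infinite) of the filtration $\mathcal F_n=\sigma(X_j^k:\,j\le n,\,k\in[K])$ and an $\mathcal F_T$-measurable random set $d\subset[K]$. For $\alpha,\beta\in(0,1)$ let $\Delta_{\alpha,\beta}(\mathcal P_m)$ be the class of the sequential tests with $\mathsf P_{\mathcal A}(d\setminus\mathcal A\ne\emptyset)\le\alpha$ and $\mathsf P_{\mathcal A}(\mathcal A\setminus d\ne\emptyset)\le\beta$ for all $\mathcal A\in\mathcal P_m$. Let $\lambda^k(n)=\sum_{j=1}^n\log\big(f_1^k(X_j^k)/f_0^k(X_j^k)\big)$, let $\lambda^{(1)}(n)\ge\dots\ge\lambda^{(K)}(n)$ be the values $\lambda^1(n),\dots,\lambda^K(n)$ in decreasing order, and let $$T_G=\inf\{n\ge1:\ \lambda^{(m)}(n)-\lambda^{(m+1)}(n)\ge c\},\qquad c=|\log(\alpha\wedge\beta)|+\log(m(K-m)),$$ be the stopping time of the gap rule. Then for every $\mathcal A\in\mathcal P_m$, as $\alpha,\beta\to0$ at arbitrary rates, $$\mathsf E_{\mathcal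 A}[T_G]\ \sim\ \frac{|\log(\alpha\wedge\beta)|}{\eta_1^{\mathcal A}+\eta_0^{\mathcal A}}\ \sim\ \inf_{(T,d)\in\Delta_{\alpha,\beta}(\mathcal P_m)}\mathsf E_{\mathcal A}[T],$$ where $x\sim y$ means $x/y\to1$. The same holds with the infimum restricted to the sequential tests with $|d|=m$ and $\mathsf P_{\mathcal A}(d\ne\mathcal A)\le\alpha\wedge\beta$ for all $\mathcal A\in\mathcal P_m$. -/

import Mathlib

open MeasureTheory Filter Topology
open scoped ENNReal

noncomputable section

namespace SeqMultipleTesting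

/-- The two simple hypotheses for the i.i.d. observations of one stream: a `σ`-finite reference
measure and two probability densities with respect to it. Index `0` is noise, index `1` signal. -/
structure TestingPair (E : Type*) [MeasurableSpace E] where
  ref : Measure E
  sigmaFinite_ref : SigmaFinite ref
  density : Fin 2 → E → ℝ
  measurable_density : ∀ i, Measurable (density i)
  density_nonneg : ∀ i x, 0 ≤ density i x
  lintegral_density : ∀ i, ∫⁻ x, ENNReal.ofReal (density i x) ∂ref = 1

namespace TestingPair

variable {E : Type*} [MeasurableSpace E]

/-- The law of one observation under hypothesis `i`. -/
def law (S : TestingPair E) (i : Fin 2) : Measure E :=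
  S.ref.withDensity (fun x => ENNReal.ofReal (S.density i x))

instance isProbabilityMeasure_law (S : TestingPair E) (i : Fin 2) :
    IsProbabilityMeasure (S.law i) :=
  ⟨by rw [law, withDensity_apply _ MeasurableSet.univ, Measure.restrict_univ,
    S.lintegral_density i]⟩

/-- The law `P_i` of the whole sequence of observations of the stream under hypothesis `i`. -/
def seqLaw (S : TestingPair E) (i : Fin 2) : Measure (ℕ → E) :=
  Measure.infinitePi (fun _ : ℕ => S.law i)

/-- The log-likelihood ratio `log (f₁ / f₀)` of one observation. -/
def llr (S : TestingPair E) (x : E) : ℝ :=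
  Real.log (S.density 1 x / S.density 0 x)

/-- The Kullback-Leibler number `D₀ = ∫ log (f₀ / f₁) f₀ dμ`. -/
def D0 (S : TestingPair E) : ℝ :=
  ∫ x, Real.log (S.density 0 x / S.density 1 x) * S.density 0 x ∂S.ref

/-- The Kullback-Leibler number `D₁ = ∫ log (f₁ / f₀) f₁ dμ`. -/
def D1 (S : TestingPair E) : ℝ :=
  ∫ x, Real.log (S.density 1 x / S.density 0 x) * S.density 1 x ∂S.ref

/-- The two hypotheses are mutually absolutely continuous. For i.i.d. observations it is the same
to require this for one observation or for any finite number of them. -/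
def MutuallyAC (S : TestingPair E) : Prop :=
  S.law 0 ≪ S.law 1 ∧ S.law 1 ≪ S.law 0

/-- The Kullback-Leibler numbers `D₀`, `D₁` are finite and positive. -/
def KLFinitePos (S : TestingPair E) : Prop :=
  (Integrable (fun x => Real.log (S.density 0 x / S.density 1 x) * S.density 0 x) S.ref
    ∧ 0 < S.D0) ∧
  (Integrable (fun x => Real.log (S.density 1 x / S.density 0 x) * S.density 1 x) S.ref
    ∧ 0 < S.D1)

/-- The log-likelihood ratio of one observation has finite second moment under both hypotheses. -/
def FiniteSecondMoment (S : TestingPair E) : Prop :=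
  ∀ i : Fin 2, Integrable
    (fun x => (Real.log (S.density 0 x / S.density 1 x)) ^ 2 * S.density i x) S.ref

end TestingPair

variable {K : ℕ} {E : Fin K → Type*} [∀ k, MeasurableSpace (E k)]

/-- The sample space: `ω k j` is the observation of stream `k` at time `j + 1`. -/
abbrev Path (E : Fin K → Type*) : Type _ := (k : Fin K) → ℕ → E k

/-- The measure `P_A`: independent streams, stream `k` being signal if `k ∈ A`, noise if not. -/
def prob (S : (k : Fin K) → TestingPair (E k)) (A : Finset (Fin K)) : Measure (Path E) :=
  Measure.pi (fun k => (S k).seqLaw (if k ∈ A then 1 else 0))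

/-- The filtration: `ℱ n` is generated by the first `n` observations of all streams. -/
def obsFiltration (E : Fin K → Type*) [∀ k, MeasurableSpace (E k)] :
    Filtration ℕ (inferInstance : MeasurableSpace (Path E)) where
  seq n := MeasurableSpace.comap
    (fun (ω : Path E) (k : Fin K) (j : Fin n) => ω k j) inferInstance
  mono' := by
    intro n n' h
    have hg : Measurable (fun (x : (k : Fin K) → Fin n' → E k) (k : Fin K) (j : Fin n) =>
        x k (Fin.castLE h j)) := by fun_prop
    rintro s ⟨t, ht, rfl⟩
    exact ⟨_, hg ht, rfl⟩
  le' := by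
    intro n
    refine Measurable.comap_le ?_
    fun_prop

/-- The cumulative log-likelihood ratio of stream `k` based on its first `n` observations. -/
def cumLLR (S : (k : Fin K) → TestingPair (E k)) (k : Fin K) (n : ℕ) (ω : Path E) : ℝ :=
  ∑ j ∈ Finset.range n, (S k).llr (ω k j)

/-- The entries of `v` in decreasing order; position `i` (counted from `0`) holds the
`(i + 1)`-st largest entry. -/
def decreasing (v : Fin K → ℝ) (i : Fin K) : ℝ :=
  v (Tuple.sort (fun k => - v k) i)

/-- The stopping time of the gap rule with threshold `c`: the first `n ≥ 1` at which the `m`-th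
largest cumulative log-likelihood ratio exceeds the `(m + 1)`-st largest by at least `c`. -/
def gapTime (S : (k : Fin K) → TestingPair (E k)) (m : ℕ) (hmK : m < K) (c : ℝ)
    (ω : Path E) : ℕ∞ :=
  ⨅ (n : ℕ) (_ : 1 ≤ n ∧
    c ≤ decreasing (fun k => cumLLR S k n ω) ⟨m - 1, by omega⟩
      - decreasing (fun k => cumLLR S k n ω) ⟨m, hmK⟩), (n : ℕ∞)

/-- The threshold `c = |log (α ∧ β)| + log (m (K - m))`. -/
def gapThreshold (K m : ℕ) (α β : ℝ) : ℝ :=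
  |Real.log (min α β)| + Real.log ((m : ℝ) * ((K : ℝ) - (m : ℝ)))

/-- A sequential test `(T, d)`: `T` is a stopping time with values in `{1, 2, …, ∞}` and the set
`d` of streams that are declared to be signals is `ℱ_T`-measurable. -/
def IsSequentialTest (T : Path E → ℕ∞) (d : Path E → Finset (Fin K)) : Prop :=
  (∀ ω, 1 ≤ T ω) ∧
  ∃ hT : IsStoppingTime (obsFiltration E) T, ∀ k, MeasurableSet[hT.measurableSpace] {ω | k ∈ d ω}

/-- The class `Δ_{α,β}(𝒫)`: for every `A ∈ 𝒫` the familywise error of type I is at most `α` and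
that of type II is at most `β`. -/
def admissible (S : (k : Fin K) → TestingPair (E k)) (P : Set (Finset (Fin K))) (α β : ℝ) :
    Set ((Path E → ℕ∞) × (Path E → Finset (Fin K))) :=
  {p | IsSequentialTest p.1 p.2 ∧ ∀ A ∈ P,
    prob S A {ω | (p.2 ω \ A).Nonempty} ≤ ENNReal.ofReal α ∧
    prob S A {ω | (A \ p.2 ω).Nonempty} ≤ ENNReal.ofReal β}

/-- The class of sets of exactly `m` streams. -/
def exactly (K m : ℕ) : Set (Finset (Fin K)) := {A | A.card = m}

/-- The form of the class `Δ_{α,β}(𝒫_m)` for tests that always declare exactly `m` signals. -/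
def admissibleExactly (S : (k : Fin K) → TestingPair (E k)) (m : ℕ) (α β : ℝ) :
    Set ((Path E → ℕ∞) × (Path E → Finset (Fin K))) :=
  {p | IsSequentialTest p.1 p.2 ∧ (∀ ω, (p.2 ω).card = m) ∧ ∀ A ∈ exactly K m,
    prob S A {ω | p.2 ω ≠ A} ≤ ENNReal.ofReal (min α β)}

/-- The expectation `E_A[T]`, in `[0, ∞]`. -/
def expTime (S : (k : Fin K) → TestingPair (E k)) (A : Finset (Fin K)) (T : Path E → ℕ∞) :
    ℝ≥0∞ :=
  ∫⁻ ω, (T ω : ℝ≥0∞) ∂(prob S A)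

/-- The infimum of `E_A[T]` over a class of tests, in `[0, ∞]`. -/
def infTime (S : (k : Fin K) → TestingPair (E k)) (A : Finset (Fin K))
    (Δ : Set ((Path E → ℕ∞) × (Path E → Finset (Fin K)))) : ℝ≥0∞ :=
  ⨅ p ∈ Δ, expTime S A p.1

/-- `η₁^A`, the minimum of `D₁` over the streams in `A` (`∞` if there are none). -/
def eta1 (S : (k : Fin K) → TestingPair (E k)) (A : Finset (Fin K)) : ℝ≥0∞ :=
  ⨅ k ∈ A, ENNReal.ofReal (S k).D1

/-- `η₀^A`, the minimum of `D₀` over the streams outside `A` (`∞` if there are none). -/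
def eta0 (S : (k : Fin K) → TestingPair (E k)) (A : Finset (Fin K)) : ℝ≥0∞ :=
  ⨅ k ∈ Aᶜ, ENNReal.ofReal (S k).D0

/-- The rate `|log (α ∧ β)| / (η₁^A + η₀^A)`. -/
def rate (S : (k : Fin K) → TestingPair (E k)) (A : Finset (Fin K)) (α β : ℝ) : ℝ≥0∞ :=
  ENNReal.ofReal |Real.log (min α β)| / (eta1 S A + eta0 S A)

/-- `x ∼ y` as `α, β ↓ 0` at arbitrary rates: the quotient `x / y` tends to `1`. -/
def AsympEquiv (x y : ℝ → ℝ → ℝ≥0∞) : Prop :=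
  Tendsto (fun p : ℝ × ℝ => x p.1 p.2 / y p.1 p.2) (𝓝[>] 0 ×ˢ 𝓝[>] 0) (𝓝 1)

end SeqMultipleTesting

end

/-!
Let `D = η₁ + η₀`, the smallest drift of `λⁱ - λʲ` over the pairs of a signal `i` and a noise
stream `j` under `P_A`, and let `L = |log (α ∧ β)|`. All three quantities are equivalent to `L / D`.

*Upper bound.* The gap rule has stopped as soon as each signal has collected evidence `c η₁ / D` and
each noise stream evidence `c η₀ / D` in favour of its true hypothesis. The evidence against the
true hypothesis is the logarithm of a likelihood ratio of mean `1`, so its exponential moment is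
finite, and Chernoff's bound gives geometric tails at every speed below the drift
(`TestingPair.exists_seqLaw_sum_evidence_lt_le`). Summing the tails bounds `E_A[T_G]` by
`c / (ρ D)` plus a constant, for each `ρ < 1` (`exists_expTime_gapTime_le`).

*Admissibility.* If the gap rule errs, some noise stream `j` is ahead of some signal `i` by `c`. The
change of measure from `A` to the set `C` in which `i` and `j` are exchanged bounds the probability
of this by `exp (-c)`, and there are `m (K - m)` pairs (`prob_gapDecision_ne_le`). Hence both infima
are at most `E_A[T_G]`.

*Lower bound.* Let `i` and `j` attain the minima in `η₁` and `η₀`, so that the log-likelihood ratio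
of `P_A` against `P_C` is `λⁱ - λʲ`, of drift `D`. An admissible test distinguishes `P_A` from
`P_C` with error at most `α ∧ β` on the side of `C`. By the change of measure at the time of
stopping it can stop before `(1 - δ) L / D` only if the log-likelihood ratio has come near `L` by
then, which the strong law makes unlikely (`prob_le_of_isStoppingTime`,
`tendsto_prob_exists_logLR_gt`), uniformly over the admissible tests (`eventually_le_infTime`).
-/

namespace SeqMultipleTesting

open ProbabilityTheory

/-! ### Exponential moments and sums of i.i.d. variables -/

/-- If `exp (-X)` and `X` are integrable then the derivative of `s ↦ E[exp (-s X)]` at `0` from the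
right is `-E[X]`; hence `E[exp (-s X)] ≤ exp (-s d)` for some small `s > 0`, for each `d < E[X]`. -/
lemma exists_lintegral_exp_neg_mul_le {Ω : Type*} [MeasurableSpace Ω] {μ : Measure Ω}
    [IsProbabilityMeasure μ] {X : Ω → ℝ} (hX : Integrable X μ)
    (hexp : Integrable (fun ω => Real.exp (-X ω)) μ) {d : ℝ} (hd : d < ∫ ω, X ω ∂μ) :
    ∃ s : ℝ, 0 < s ∧
      ∫⁻ ω, ENNReal.ofReal (Real.exp (-(s * X ω))) ∂μ ≤ ENNReal.ofReal (Real.exp (-(s * d))) := by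
  -- convexity of `exp` gives the integrable majorant of the difference quotients
  have hconv : ∀ s x : ℝ, 0 ≤ s → s ≤ 1 →
      Real.exp (-(s * x)) ≤ s * Real.exp (-x) + (1 - s) := by
    intro s x h0 h1
    have := convexOn_exp.2 (Set.mem_univ (-x)) (Set.mem_univ 0) h0
      (by linarith : 0 ≤ 1 - s) (by ring)
    simpa using this
  have hmeas : ∀ s : ℝ, AEStronglyMeasurable (fun ω => Real.exp (-(s * X ω))) μ := fun s =>
    Real.continuous_exp.comp_aestronglyMeasurable (hX.1.const_mul s).neg
  have hint : ∀ s : ℝ, 0 ≤ s → s ≤ 1 → Integrable (fun ω => Real.exp (-(s * X ω))) μ := by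
    intro s h0 h1
    refine ((hexp.const_mul s).add (integrable_const (1 - s))).mono' (hmeas s) ?_
    filter_upwards with ω
    rw [Real.norm_eq_abs, abs_of_pos (Real.exp_pos _)]
    exact hconv s (X ω) h0 h1
  have hlim : Tendsto (fun s : ℝ => ∫ ω, (1 - Real.exp (-(s * X ω))) / s ∂μ) (𝓝[>] 0)
      (𝓝 (∫ ω, X ω ∂μ)) := by
    refine tendsto_integral_filter_of_dominated_convergence
      (fun ω => |X ω| + Real.exp (-X ω)) ?_ ?_ (hX.abs.add hexp) ?_
    · filter_upwards with s
      simp only [div_eq_mul_inv]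
      exact AEStronglyMeasurable.mul_const (aestronglyMeasurable_const.sub (hmeas s)) s⁻¹
    · filter_upwards [Ioc_mem_nhdsGT (zero_lt_one' ℝ)] with s hs
      filter_upwards with ω
      have h1 := hconv s (X ω) hs.1.le hs.2
      have h2 := Real.add_one_le_exp (-(s * X ω))
      have h3 := Real.exp_pos (-X ω)
      have h4 : X ω ≤ |X ω| := le_abs_self _
      have h5 : 0 ≤ |X ω| := abs_nonneg _
      have hs0 : 0 < s := hs.1
      rw [Real.norm_eq_abs, abs_le, le_div_iff₀ hs.1, div_le_iff₀ hs.1]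
      constructor
      · nlinarith [mul_nonneg hs0.le h5]
      · nlinarith [mul_nonneg hs0.le h3.le, mul_le_mul_of_nonneg_left h4 hs0.le]
    · filter_upwards with ω
      have hder : HasDerivAt (fun s : ℝ => 1 - Real.exp (-(s * X ω))) (X ω) 0 := by
        have h := (((hasDerivAt_id (0 : ℝ)).mul_const (X ω)).neg.exp).const_sub 1
        simpa using h
      have := hder.tendsto_slope.mono_left
        (nhdsWithin_mono 0 (fun s (hs : s ∈ Set.Ioi 0) => (ne_of_gt hs : s ≠ 0)))
      refine this.congr fun s => ?_
      simp [slope_def_field]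
  obtain ⟨s, hsd, hs⟩ := ((hlim.eventually (lt_mem_nhds hd)).and
    (Ioc_mem_nhdsGT (zero_lt_one' ℝ))).exists
  have hs0 : 0 < s := hs.1
  refine ⟨s, hs0, ?_⟩
  rw [← ofReal_integral_eq_lintegral_ofReal (hint s hs0.le hs.2)
    (ae_of_all _ fun _ => (Real.exp_pos _).le)]
  refine ENNReal.ofReal_le_ofReal ?_
  have hsplit : ∫ ω, (1 - Real.exp (-(s * X ω))) / s ∂μ
      = (1 - ∫ ω, Real.exp (-(s * X ω)) ∂μ) / s := by
    rw [integral_div, integral_sub (integrable_const _) (hint s hs0.le hs.2)]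
    simp
  rw [hsplit, lt_div_iff₀ hs0] at hsd
  have := Real.add_one_le_exp (-(s * d))
  linarith

/-- Chernoff's bound for the lower tail of a sum of i.i.d. variables. -/
lemma infinitePi_sum_lt_le {E : Type*} [MeasurableSpace E] (μ : Measure E)
    [IsProbabilityMeasure μ] {X : E → ℝ} (hX : Measurable X) {s d : ℝ} (hs : 0 < s)
    (h : ∫⁻ x, ENNReal.ofReal (Real.exp (-(s * X x))) ∂μ ≤ ENNReal.ofReal (Real.exp (-(s * d))))
    (n : ℕ) (x : ℝ) :
    Measure.infinitePi (fun _ : ℕ => μ) {ω | ∑ j ∈ Finset.range n, X (ω j) < x}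
      ≤ ENNReal.ofReal (Real.exp (s * (x - n * d))) := by
  set P := Measure.infinitePi (fun _ : ℕ => μ)
  have hg : Measurable fun y : E => ENNReal.ofReal (Real.exp (-(s * X y))) := by fun_prop
  have hprod : ∫⁻ ω, ∏ j ∈ Finset.range n, ENNReal.ofReal (Real.exp (-(s * X (ω j)))) ∂P
      ≤ ENNReal.ofReal (Real.exp (-(s * d))) ^ n := by
    rw [lintegral_prod_eq_prod_lintegral_of_indepFun (Finset.range n)
      (fun j (ω : ℕ → E) => ENNReal.ofReal (Real.exp (-(s * X (ω j)))))
      (iIndepFun_infinitePi (P := fun _ : ℕ => μ) (fun _ => hg))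
      (fun j => hg.comp (measurable_pi_apply j))]
    calc ∏ j ∈ Finset.range n, ∫⁻ ω, ENNReal.ofReal (Real.exp (-(s * X (ω j)))) ∂P
        ≤ ∏ _j ∈ Finset.range n, ENNReal.ofReal (Real.exp (-(s * d))) := by
          refine Finset.prod_le_prod' fun j _ => le_trans (le_of_eq ?_) h
          exact (measurePreserving_eval_infinitePi (fun _ : ℕ => μ) j).lintegral_comp hg
      _ = _ := by simp
  have hmarkov := meas_ge_le_lintegral_div (μ := P)
    (f := fun ω => ∏ j ∈ Finset.range n, ENNReal.ofReal (Real.exp (-(s * X (ω j)))))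
    (Finset.measurable_prod _ fun j _ => hg.comp (measurable_pi_apply j)).aemeasurable
    (ε := ENNReal.ofReal (Real.exp (-(s * x))))
    (by simp [Real.exp_pos]) ENNReal.ofReal_ne_top
  calc P {ω | ∑ j ∈ Finset.range n, X (ω j) < x}
      ≤ P {ω | ENNReal.ofReal (Real.exp (-(s * x)))
          ≤ ∏ j ∈ Finset.range n, ENNReal.ofReal (Real.exp (-(s * X (ω j))))} := by
        refine measure_mono fun ω (hω : _ < x) => ?_
        rw [Set.mem_ofPred_eq, ← ENNReal.ofReal_prod_of_nonneg fun _ _ => (Real.exp_pos _).le,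
          ← Real.exp_sum, Finset.sum_neg_distrib, ← Finset.mul_sum]
        gcongr
    _ ≤ ENNReal.ofReal (Real.exp (-(s * d))) ^ n / ENNReal.ofReal (Real.exp (-(s * x))) :=
        hmarkov.trans (by gcongr)
    _ = ENNReal.ofReal (Real.exp (s * (x - n * d))) := by
        rw [← ENNReal.ofReal_pow (Real.exp_pos _).le, ← Real.exp_nat_mul,
          ← ENNReal.ofReal_div_of_pos (Real.exp_pos _), ← Real.exp_sub]
        congr 2
        ring

/-- The strong law of large numbers for the coordinates of an infinite product measure. -/
lemma ae_tendsto_infinitePi_sum_div {E : Type*} [MeasurableSpace E] (μ : Measure E)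
    [IsProbabilityMeasure μ] {X : E → ℝ} (hX : Measurable X) (hint : Integrable X μ) :
    ∀ᵐ ω ∂Measure.infinitePi (fun _ : ℕ => μ),
      Tendsto (fun n : ℕ => (∑ j ∈ Finset.range n, X (ω j)) / n) atTop (𝓝 (∫ x, X x ∂μ)) := by
  have hmp := fun j : ℕ => measurePreserving_eval_infinitePi (fun _ : ℕ => μ) j
  have h := strong_law_ae_real (μ := Measure.infinitePi (fun _ : ℕ => μ))
    (fun j ω => X (ω j)) ((hmp 0).integrable_comp_of_integrable hint)
    (fun i j hij => (iIndepFun_infinitePi (P := fun _ : ℕ => μ) (fun _ => hX)).indepFun hij)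
    (fun j => ⟨(hX.comp (measurable_pi_apply j)).aemeasurable,
      (hX.comp (measurable_pi_apply 0)).aemeasurable, by
      rw [show (fun ω : ℕ → E => X (ω j)) = X ∘ Function.eval j from rfl,
        show (fun ω : ℕ → E => X (ω 0)) = X ∘ Function.eval 0 from rfl,
        ← Measure.map_map hX (by fun_prop), ← Measure.map_map hX (by fun_prop),
        (hmp j).map_eq, (hmp 0).map_eq]⟩)
  have heq : ∫ ω, X (ω 0) ∂Measure.infinitePi (fun _ : ℕ => μ) = ∫ x, X x ∂μ := by
    conv_rhs => rw [← (hmp 0).map_eq]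
    rw [integral_map (hmp 0).measurable.aemeasurable
      hX.aestronglyMeasurable]
  rwa [heq] at h

/-! ### The likelihood ratio of one stream -/

namespace TestingPair

variable {E : Type*} [MeasurableSpace E] (S : TestingPair E)

/-- The log-likelihood ratio `log (fᵢ / f₁₋ᵢ)` of one observation in favour of hypothesis `i`. -/
noncomputable def evidence (i : Fin 2) (x : E) : ℝ :=
  Real.log (S.density i x / S.density (1 - i) x)

/-- The Kullback-Leibler number `Dᵢ = ∫ log (fᵢ / f₁₋ᵢ) fᵢ dμ`. -/
noncomputable def kl (i : Fin 2) : ℝ :=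
  if i = 1 then S.D1 else S.D0

lemma evidence_one (x : E) : S.evidence 1 x = S.llr x := rfl

lemma evidence_zero (x : E) : S.evidence 0 x = -S.llr x := by
  rw [llr, ← Real.log_inv, inv_div]
  rfl

lemma measurable_evidence (i : Fin 2) : Measurable (S.evidence i) :=
  Real.measurable_log.comp ((S.measurable_density i).div (S.measurable_density (1 - i)))

lemma measurable_llr : Measurable S.llr := S.measurable_evidence 1

lemma absolutelyContinuous_law (hac : S.MutuallyAC) (i j : Fin 2) : S.law i ≪ S.law j := by
  fin_cases i <;> fin_cases j
  exacts [Measure.AbsolutelyContinuous.refl _, hac.1, hac.2, Measure.AbsolutelyContinuous.refl _]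

lemma ae_density_eq_zero (hac : S.MutuallyAC) (i j : Fin 2) :
    ∀ᵐ x ∂S.ref, S.density i x = 0 → S.density j x = 0 := by
  have hm : ∀ l, Measurable fun x => ENNReal.ofReal (S.density l x) :=
    fun l => (S.measurable_density l).ennreal_ofReal
  have h : S.law j {x | S.density i x = 0} = 0 := by
    refine S.absolutelyContinuous_law hac j i ?_
    rw [law, withDensity_apply_eq_zero (hm i)]
    convert measure_empty (μ := S.ref)
    ext x
    simp only [Set.mem_inter_iff, Set.mem_ofPred_eq, Set.mem_empty_iff_false, iff_false]
    rintro ⟨h1, h2⟩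
    simp [h2] at h1
  rw [law, withDensity_apply_eq_zero (hm j)] at h
  filter_upwards [measure_eq_zero_iff_ae_notMem.1 h] with x hx h0
  by_contra hne
  refine hx ⟨?_, h0⟩
  simpa using lt_of_le_of_ne (S.density_nonneg j x) (Ne.symm hne)

/-- The likelihood ratio is the density of one law with respect to the other. Where a density
vanishes so does the other, outside a null set, and the junk values of `evidence` do not matter. -/
lemma law_eq_withDensity (hac : S.MutuallyAC) (i : Fin 2) :
    S.law (1 - i)
      = (S.law i).withDensity fun x => ENNReal.ofReal (Real.exp (-S.evidence i x)) := by
  have hm : ∀ l, Measurable fun x => ENNReal.ofReal (S.density l x) :=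
    fun l => (S.measurable_density l).ennreal_ofReal
  have he : Measurable fun x => ENNReal.ofReal (Real.exp (-S.evidence i x)) :=
    (Real.measurable_exp.comp (S.measurable_evidence i).neg).ennreal_ofReal
  rw [law, law, ← withDensity_mul _ (hm i) he]
  refine withDensity_congr_ae ?_
  filter_upwards [S.ae_density_eq_zero hac i (1 - i), S.ae_density_eq_zero hac (1 - i) i]
    with x h1 h2
  rw [Pi.mul_apply, ← ENNReal.ofReal_mul (S.density_nonneg i x)]
  rcases eq_or_ne (S.density i x) 0 with h0 | h0
  · rw [h1 h0, h0, zero_mul]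
  · have hp : 0 < S.density i x := lt_of_le_of_ne (S.density_nonneg i x) h0.symm
    have hq : 0 < S.density (1 - i) x :=
      lt_of_le_of_ne (S.density_nonneg (1 - i) x) fun h => h0 (h2 h.symm)
    rw [evidence, ← Real.log_inv, inv_div, Real.exp_log (by positivity)]
    congr 1
    field_simp

lemma integrable_exp_neg_evidence (hac : S.MutuallyAC) (i : Fin 2) :
    Integrable (fun x => Real.exp (-S.evidence i x)) (S.law i) := by
  refine ⟨(Real.measurable_exp.comp (S.measurable_evidence i).neg).aestronglyMeasurable, ?_⟩
  have h : ∫⁻ x, ENNReal.ofReal (Real.exp (-S.evidence i x)) ∂S.law i = 1 := by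
    rw [← setLIntegral_univ, ← withDensity_apply _ MeasurableSet.univ,
      ← S.law_eq_withDensity hac i, measure_univ]
  rw [hasFiniteIntegral_iff_ofReal (ae_of_all _ fun _ => (Real.exp_pos _).le), h]
  exact ENNReal.one_lt_top

lemma integrable_evidence (hkl : S.KLFinitePos) (i : Fin 2) :
    Integrable (S.evidence i) (S.law i) := by
  rw [law, integrable_withDensity_iff (S.measurable_density i).ennreal_ofReal
    (ae_of_all _ fun _ => ENNReal.ofReal_lt_top)]
  simp only [ENNReal.toReal_ofReal (S.density_nonneg i _)]
  fin_cases i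
  exacts [hkl.1.1, hkl.2.1]

lemma integral_evidence (i : Fin 2) : ∫ x, S.evidence i x ∂S.law i = S.kl i := by
  rw [law, integral_withDensity_eq_integral_toReal_smul (S.measurable_density i).ennreal_ofReal
    (ae_of_all _ fun _ => ENNReal.ofReal_lt_top)]
  simp only [ENNReal.toReal_ofReal (S.density_nonneg i _), smul_eq_mul, mul_comm (S.density i _)]
  fin_cases i
  · simp [kl, D0, evidence]
  · simp [kl, D1, evidence]

/-- The cumulative evidence in favour of the true hypothesis has an exponentially small lower tail
at each speed `d` below its drift `Dᵢ`. No moment beyond the first is needed, because the evidence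
against the true hypothesis always has an exponential moment. -/
lemma exists_seqLaw_sum_evidence_lt_le (hac : S.MutuallyAC) (hkl : S.KLFinitePos) (i : Fin 2)
    {d : ℝ} (hd : d < S.kl i) :
    ∃ s : ℝ, 0 < s ∧ ∀ (n : ℕ) (x : ℝ),
      S.seqLaw i {ω | ∑ j ∈ Finset.range n, S.evidence i (ω j) < x}
        ≤ ENNReal.ofReal (Real.exp (s * (x - n * d))) := by
  obtain ⟨s, hs, h⟩ := exists_lintegral_exp_neg_mul_le (S.integrable_evidence hkl i)
    (S.integrable_exp_neg_evidence hac i) (hd.trans_eq (S.integral_evidence i).symm)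
  exact ⟨s, hs, infinitePi_sum_lt_le (S.law i) (S.measurable_evidence i) hs h⟩

lemma ae_tendsto_sum_evidence_div (hkl : S.KLFinitePos) (i : Fin 2) :
    ∀ᵐ ω ∂S.seqLaw i,
      Tendsto (fun n : ℕ => (∑ j ∈ Finset.range n, S.evidence i (ω j)) / n) atTop
        (𝓝 (S.kl i)) := by
  rw [← S.integral_evidence i]
  exact ae_tendsto_infinitePi_sum_div (S.law i) (S.measurable_evidence i)
    (S.integrable_evidence hkl i)

end TestingPair

/-! ### The joint law of the streams -/

variable {K : ℕ} {E : Fin K → Type*} [∀ k, MeasurableSpace (E k)]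

/-- The hypothesis that stream `k` follows when `A` is the set of signals. -/
abbrev hypothesis (A : Finset (Fin K)) (k : Fin K) : Fin 2 := if k ∈ A then 1 else 0

instance (S : (k : Fin K) → TestingPair (E k)) (k : Fin K) (i : Fin 2) :
    IsProbabilityMeasure ((S k).seqLaw i) := by
  unfold TestingPair.seqLaw
  infer_instance

instance (S : (k : Fin K) → TestingPair (E k)) (A : Finset (Fin K)) :
    IsProbabilityMeasure (prob S A) := by
  unfold prob
  infer_instance

lemma measurePreserving_eval_prob (S : (k : Fin K) → TestingPair (E k)) (A : Finset (Fin K))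
    (k : Fin K) :
    MeasurePreserving (Function.eval k) (prob S A) ((S k).seqLaw (hypothesis A k)) :=
  measurePreserving_eval (fun k => (S k).seqLaw (hypothesis A k)) k

/-- The cumulative evidence in favour of the hypothesis that stream `k` follows when `A` is the set
of signals: `λᵏ(n)` for a signal and `-λᵏ(n)` for noise. -/
noncomputable def cumEvidence (S : (k : Fin K) → TestingPair (E k)) (A : Finset (Fin K))
    (k : Fin K) (n : ℕ) (ω : Path E) : ℝ :=
  ∑ j ∈ Finset.range n, (S k).evidence (hypothesis A k) (ω k j)

lemma cumEvidence_of_mem (S : (k : Fin K) → TestingPair (E k)) {A : Finset (Fin K)} {k : Fin K}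
    (hk : k ∈ A) (n : ℕ) (ω : Path E) : cumEvidence S A k n ω = cumLLR S k n ω := by
  simp [cumEvidence, cumLLR, hypothesis, hk, TestingPair.evidence_one]

lemma cumEvidence_of_notMem (S : (k : Fin K) → TestingPair (E k)) {A : Finset (Fin K)}
    {k : Fin K} (hk : k ∉ A) (n : ℕ) (ω : Path E) :
    cumEvidence S A k n ω = -cumLLR S k n ω := by
  simp [cumEvidence, cumLLR, hypothesis, hk, TestingPair.evidence_zero]

lemma exists_prob_cumEvidence_lt_le (S : (k : Fin K) → TestingPair (E k))
    (hac : ∀ k, (S k).MutuallyAC) (hkl : ∀ k, (S k).KLFinitePos) (A : Finset (Fin K)) (k : Fin K)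
    {d : ℝ} (hd : d < (S k).kl (hypothesis A k)) :
    ∃ s : ℝ, 0 < s ∧ ∀ (n : ℕ) (x : ℝ),
      prob S A {ω | cumEvidence S A k n ω < x} ≤ ENNReal.ofReal (Real.exp (s * (x - n * d))) := by
  obtain ⟨s, hs, h⟩ := (S k).exists_seqLaw_sum_evidence_lt_le (hac k) (hkl k) _ hd
  refine ⟨s, hs, fun n x => (le_of_eq ?_).trans (h n x)⟩
  refine (measurePreserving_eval_prob S A k).measure_preimage (s := {ω | ∑ j ∈ Finset.range n,
    (S k).evidence (hypothesis A k) (ω j) < x}) (MeasurableSet.nullMeasurableSet ?_)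
  exact measurableSet_lt (Finset.measurable_sum _ fun j _ =>
    ((S k).measurable_evidence _).comp (measurable_pi_apply j)) measurable_const

lemma ae_tendsto_cumEvidence_div (S : (k : Fin K) → TestingPair (E k))
    (hkl : ∀ k, (S k).KLFinitePos) (A : Finset (Fin K)) (k : Fin K) :
    ∀ᵐ ω ∂prob S A, Tendsto (fun n : ℕ => cumEvidence S A k n ω / n) atTop
      (𝓝 ((S k).kl (hypothesis A k))) :=
  (measurePreserving_eval_prob S A k).quasiMeasurePreserving.ae
    ((S k).ae_tendsto_sum_evidence_div (hkl k) _)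

lemma measurable_cumLLR (S : (k : Fin K) → TestingPair (E k)) (k : Fin K) (n : ℕ) :
    Measurable[obsFiltration E n] (cumLLR S k n) := by
  have h : Measurable fun x : (k : Fin K) → Fin n → E k => ∑ j, (S k).llr (x k j) :=
    Finset.measurable_sum _ fun j _ => (S k).measurable_llr.comp (by fun_prop)
  have heq : cumLLR S k n
      = (fun x : (k : Fin K) → Fin n → E k => ∑ j, (S k).llr (x k j))
        ∘ fun (ω : Path E) (k : Fin K) (j : Fin n) => ω k j := by
    ext ω
    exact Finset.sum_range fun j => (S k).llr (ω k j)
  rw [heq]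
  exact h.comp (comap_measurable _)

/-! ### Change of measure -/

lemma pi_withDensity {ι : Type*} [Fintype ι] {X : ι → Type*} [∀ i, MeasurableSpace (X i)]
    (μ : ∀ i, Measure (X i)) [∀ i, IsProbabilityMeasure (μ i)] {f : ∀ i, X i → ℝ≥0∞}
    (hf : ∀ i, Measurable (f i)) [∀ i, SigmaFinite ((μ i).withDensity (f i))] :
    Measure.pi (fun i => (μ i).withDensity (f i))
      = (Measure.pi μ).withDensity fun x => ∏ i, f i (x i) := by
  refine Measure.pi_eq fun s hs => ?_
  have hg : ∀ i, Measurable ((s i).indicator (f i)) := fun i => (hf i).indicator (hs i)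
  have hind : ∀ x : ∀ i, X i, (Set.univ.pi s).indicator (fun x => ∏ i, f i (x i)) x
      = ∏ i, (s i).indicator (f i) (x i) := by
    intro x
    by_cases hx : x ∈ Set.univ.pi s
    · rw [Set.indicator_of_mem hx]
      exact Finset.prod_congr rfl fun i _ => (Set.indicator_of_mem (hx i trivial) _).symm
    · rw [Set.indicator_of_notMem hx]
      simp only [Set.mem_pi, Set.mem_univ, true_implies, not_forall] at hx
      obtain ⟨i, hi⟩ := hx
      exact (Finset.prod_eq_zero (Finset.mem_univ i) (Set.indicator_of_notMem hi _)).symm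
  rw [withDensity_apply _ (MeasurableSet.univ_pi hs), ← lintegral_indicator
    (MeasurableSet.univ_pi hs), lintegral_congr hind,
    lintegral_prod_eq_prod_lintegral_of_indepFun Finset.univ
      (fun i (x : ∀ i, X i) => (s i).indicator (f i) (x i))
      (iIndepFun_pi fun i => (hg i).aemeasurable) (fun i => (hg i).comp (measurable_pi_apply i))]
  refine Finset.prod_congr rfl fun i _ => ?_
  rw [(measurePreserving_eval μ i).lintegral_comp (hg i), lintegral_indicator (hs i),
    withDensity_apply _ (hs i)]

lemma prob_map_prefix (S : (k : Fin K) → TestingPair (E k)) (A : Finset (Fin K)) (n : ℕ) :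
    (prob S A).map (fun (ω : Path E) (k : Fin K) (j : Fin n) => ω k j)
      = Measure.pi fun k => Measure.pi fun _ : Fin n => (S k).law (hypothesis A k) := by
  have h : ∀ k, ((S k).seqLaw (hypothesis A k)).map (fun (ω : ℕ → E k) (j : Fin n) => ω j)
      = Measure.pi fun _ : Fin n => (S k).law (hypothesis A k) := by
    intro k
    rw [TestingPair.seqLaw, Measure.map_infinitePi_infinitePi_of_inj Fin.val_injective,
      Measure.infinitePi_eq_pi]
  have : ∀ k, SigmaFinite (((S k).seqLaw (hypothesis A k)).map
      (fun (ω : ℕ → E k) (j : Fin n) => ω j)) := by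
    intro k
    rw [h k]
    infer_instance
  exact (Measure.pi_map_pi (μ := fun k => (S k).seqLaw (hypothesis A k))
    (f := fun k (ω : ℕ → E k) (j : Fin n) => ω j)
    (fun k => Measurable.aemeasurable (by fun_prop))).trans (congrArg _ (funext h))

/-- The log-likelihood ratio of `P_A` against `P_C`, based on the first `n` observations. -/
noncomputable def logLR (S : (k : Fin K) → TestingPair (E k)) (A C : Finset (Fin K)) (n : ℕ)
    (ω : Path E) : ℝ :=
  ∑ k, ((if k ∈ A then 1 else 0) - (if k ∈ C then 1 else 0)) * cumLLR S k n ω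

lemma law_hypothesis_eq_withDensity (S : (k : Fin K) → TestingPair (E k))
    (hac : ∀ k, (S k).MutuallyAC) (A C : Finset (Fin K)) (k : Fin K) :
    (S k).law (hypothesis A k) = ((S k).law (hypothesis C k)).withDensity fun x =>
      ENNReal.ofReal (Real.exp (((if k ∈ A then 1 else 0) - (if k ∈ C then 1 else 0))
        * (S k).llr x)) := by
  have h0 := (S k).law_eq_withDensity (hac k) 0
  have h1 := (S k).law_eq_withDensity (hac k) 1
  simp only [TestingPair.evidence_zero, TestingPair.evidence_one, neg_neg] at h0 h1
  by_cases hA : k ∈ A <;> by_cases hC : k ∈ C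
  · simp [hypothesis, hA, hC]
  · simpa [hypothesis, hA, hC] using h0
  · simpa [hypothesis, hA, hC] using h1
  · simp [hypothesis, hA, hC]

lemma prob_eq_setLIntegral_exp_logLR (S : (k : Fin K) → TestingPair (E k))
    (hac : ∀ k, (S k).MutuallyAC) (A C : Finset (Fin K)) (n : ℕ) {B : Set (Path E)}
    (hB : MeasurableSet[obsFiltration E n] B) :
    prob S A B = ∫⁻ ω in B, ENNReal.ofReal (Real.exp (logLR S A C n ω)) ∂prob S C := by
  obtain ⟨B', hB', rfl⟩ := hB
  set a : Fin K → ℝ := fun k => (if k ∈ A then 1 else 0) - (if k ∈ C then 1 else 0) with ha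
  set g : (k : Fin K) → E k → ℝ≥0∞ := fun k x => ENNReal.ofReal (Real.exp (a k * (S k).llr x))
    with hg_def
  have hg : ∀ k, Measurable (g k) := fun k =>
    (Real.measurable_exp.comp ((S k).measurable_llr.const_mul (a k))).ennreal_ofReal
  have hlaw : ∀ k, (S k).law (hypothesis A k) = ((S k).law (hypothesis C k)).withDensity (g k) :=
    law_hypothesis_eq_withDensity S hac A C
  have hprob : ∀ k, IsProbabilityMeasure (((S k).law (hypothesis C k)).withDensity (g k)) := by
    intro k
    rw [← hlaw k]
    infer_instance
  have hstream : ∀ k, (Measure.pi fun _ : Fin n => (S k).law (hypothesis A k))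
      = (Measure.pi fun _ : Fin n => (S k).law (hypothesis C k)).withDensity
        fun x => ∏ j, g k (x j) := by
    intro k
    rw [hlaw k, pi_withDensity _ fun _ => hg k]
  have hprob' : ∀ k, IsProbabilityMeasure ((Measure.pi fun _ : Fin n =>
      (S k).law (hypothesis C k)).withDensity fun x => ∏ j, g k (x j)) := by
    intro k
    rw [← hstream k]
    infer_instance
  have hπ : Measurable fun (ω : Path E) (k : Fin K) (j : Fin n) => ω k j := by fun_prop
  have hG : ∀ k, Measurable fun x : Fin n → E k => ∏ j, g k (x j) := fun k =>
    Finset.measurable_prod _ fun j _ => (hg k).comp (measurable_pi_apply j)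
  rw [← Measure.map_apply hπ hB', prob_map_prefix, funext hstream, pi_withDensity _ hG,
    withDensity_apply _ hB', ← prob_map_prefix, setLIntegral_map hB' _ hπ]
  · refine lintegral_congr fun ω => ?_
    have : ∀ k, ∏ j : Fin n, g k (ω k j)
        = ENNReal.ofReal (Real.exp (a k * cumLLR S k n ω)) := by
      intro k
      rw [hg_def, ← ENNReal.ofReal_prod_of_nonneg fun _ _ => (Real.exp_pos _).le, ← Real.exp_sum,
        ← Finset.mul_sum, cumLLR, Finset.sum_range]
    simp only [this]
    rw [← ENNReal.ofReal_prod_of_nonneg fun _ _ => (Real.exp_pos _).le, ← Real.exp_sum]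
    rfl
  · exact Finset.measurable_prod _ fun k _ => (hG k).comp (measurable_pi_apply k)

lemma measurable_logLR (S : (k : Fin K) → TestingPair (E k)) (A C : Finset (Fin K)) (n : ℕ) :
    Measurable[obsFiltration E n] (logLR S A C n) := by
  unfold logLR
  exact Finset.measurable_sum _ fun k _ => (measurable_cumLLR S k n).const_mul _

lemma prob_inter_logLR_le (S : (k : Fin K) → TestingPair (E k))
    (hac : ∀ k, (S k).MutuallyAC) (A C : Finset (Fin K)) (n : ℕ) {B : Set (Path E)}
    (hB : MeasurableSet[obsFiltration E n] B) (x : ℝ) :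
    prob S A (B ∩ {ω | logLR S A C n ω ≤ x})
      ≤ ENNReal.ofReal (Real.exp x) * prob S C B := by
  have hm : MeasurableSet[obsFiltration E n] (B ∩ {ω | logLR S A C n ω ≤ x}) :=
    hB.inter (measurable_logLR S A C n measurableSet_Iic)
  rw [prob_eq_setLIntegral_exp_logLR S hac A C n hm]
  calc ∫⁻ ω in B ∩ {ω | logLR S A C n ω ≤ x}, ENNReal.ofReal (Real.exp (logLR S A C n ω)) ∂prob S C
      ≤ ∫⁻ _ω in B ∩ {ω | logLR S A C n ω ≤ x}, ENNReal.ofReal (Real.exp x) ∂prob S C :=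
        setLIntegral_mono' ((obsFiltration E).le n _ hm) fun ω hω =>
          ENNReal.ofReal_le_ofReal (Real.exp_le_exp.2 hω.2)
    _ = ENNReal.ofReal (Real.exp x) * prob S C (B ∩ {ω | logLR S A C n ω ≤ x}) :=
        setLIntegral_const _ _
    _ ≤ _ := by gcongr; exact Set.inter_subset_left

/-- The change of measure at a random time: `B n` is the event that an `ℱ_T`-measurable event
occurs and `T = n`. -/
lemma prob_iUnion_inter_logLR_le (S : (k : Fin K) → TestingPair (E k))
    (hac : ∀ k, (S k).MutuallyAC) (A C : Finset (Fin K)) {B : ℕ → Set (Path E)}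
    (hB : ∀ n, MeasurableSet[obsFiltration E n] (B n))
    (hdisj : Pairwise (Function.onFun Disjoint B))
    (x : ℝ) :
    prob S A (⋃ n, B n ∩ {ω | logLR S A C n ω ≤ x})
      ≤ ENNReal.ofReal (Real.exp x) * prob S C (⋃ n, B n) := by
  rw [measure_iUnion hdisj fun n => (obsFiltration E).le n _ (hB n), ← ENNReal.tsum_mul_left]
  exact (measure_iUnion_le _).trans
    (ENNReal.tsum_le_tsum fun n => prob_inter_logLR_le S hac A C n (hB n) x)

/-- If `C` arises from `A` by exchanging the signal `i` for the noise stream `j`, then only these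
two streams matter for the likelihood ratio. -/
lemma logLR_exchange (S : (k : Fin K) → TestingPair (E k)) {A : Finset (Fin K)} {i j : Fin K}
    (hi : i ∈ A) (hj : j ∉ A) (n : ℕ) (ω : Path E) :
    logLR S A (insert j (A.erase i)) n ω = cumLLR S i n ω - cumLLR S j n ω := by
  have hij : i ≠ j := fun h => hj (h ▸ hi)
  rw [logLR, Finset.sum_eq_add i j hij]
  · simp [hi, hj, hij]
    ring
  · rintro k - ⟨hki, hkj⟩
    simp [hki, hkj]
  · simp
  · simp

lemma exchange_mem_exactly {m : ℕ} {A : Finset (Fin K)} (hA : A ∈ exactly K m) {i j : Fin K}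
    (hi : i ∈ A) (hj : j ∉ A) : insert j (A.erase i) ∈ exactly K m := by
  change _ = m
  rw [Finset.card_insert_of_notMem (fun h => hj (Finset.mem_of_mem_erase h)),
    Finset.card_erase_add_one hi]
  exact hA

/-! ### The largest entries of a vector -/

/-- The indices of the `m` largest entries of `v`, with ties broken as in `decreasing`. -/
noncomputable def topSet (m : ℕ) (v : Fin K → ℝ) : Finset (Fin K) :=
  (Finset.univ.filter fun i : Fin K => (i : ℕ) < m).map
    (Tuple.sort fun k => -v k).toEmbedding

/-- The entries of `v` with index in `A` exceed all other entries by at least `c`. -/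
def Separates (v : Fin K → ℝ) (c : ℝ) (A : Finset (Fin K)) : Prop :=
  ∀ i ∈ A, ∀ j ∉ A, c ≤ v i - v j

lemma card_topSet {m : ℕ} (hmK : m ≤ K) (v : Fin K → ℝ) : (topSet m v).card = m := by
  rw [topSet, Finset.card_map, Fin.card_filter_val_lt, min_eq_right hmK]

lemma mem_topSet {m : ℕ} {v : Fin K → ℝ} {k : Fin K} :
    k ∈ topSet m v ↔ (((Tuple.sort fun k => -v k).symm k : Fin K) : ℕ) < m := by
  simp [topSet, Finset.mem_map_equiv]

lemma antitone_decreasing (v : Fin K → ℝ) : Antitone (decreasing v) := fun a b hab => by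
  have := Tuple.monotone_sort (fun k => -v k) hab
  simpa [decreasing] using this

lemma eq_decreasing (v : Fin K → ℝ) (k : Fin K) :
    v k = decreasing v ((Tuple.sort fun k => -v k).symm k) := by
  simp [decreasing]

lemma separates_topSet {m : ℕ} (hm : 1 ≤ m) (hmK : m < K) {v : Fin K → ℝ} {c : ℝ}
    (hc : c ≤ decreasing v ⟨m - 1, by omega⟩ - decreasing v ⟨m, hmK⟩) :
    Separates v c (topSet m v) := by
  intro i hi j hj
  rw [mem_topSet] at hi hj
  rw [eq_decreasing v i, eq_decreasing v j]
  have h1 := antitone_decreasing v (a := (Tuple.sort fun k => -v k).symm i) (b := ⟨m - 1, by omega⟩)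
    (Fin.le_def.2 (by simp only; omega))
  have h2 := antitone_decreasing v (a := ⟨m, hmK⟩) (b := (Tuple.sort fun k => -v k).symm j)
    (Fin.le_def.2 (by simp only; omega))
  linarith

lemma exists_mem_notMem_of_card_eq {ι : Type*} [DecidableEq ι] {A B : Finset ι}
    (hcard : A.card = B.card) (hne : A ≠ B) : ∃ i ∈ A, i ∉ B := by
  by_contra! h
  exact hne (Finset.eq_of_subset_of_card_le h hcard.ge)

lemma topSet_eq_of_separates {m : ℕ} (hmK : m < K) {v : Fin K → ℝ} {c : ℝ} (hc : 0 < c)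
    {A : Finset (Fin K)} (hA : A.card = m) (hsep : Separates v c A) : topSet m v = A := by
  by_contra hne
  have hcard : (topSet m v).card = A.card := by rw [card_topSet hmK.le, hA]
  obtain ⟨j, hj, hjA⟩ := exists_mem_notMem_of_card_eq hcard hne
  obtain ⟨i, hiA, hi⟩ := exists_mem_notMem_of_card_eq hcard.symm (Ne.symm hne)
  have h := hsep i hiA j hjA
  rw [mem_topSet] at hi hj
  rw [eq_decreasing v i, eq_decreasing v j] at h
  have := antitone_decreasing v (a := (Tuple.sort fun k => -v k).symm j)
    (b := (Tuple.sort fun k => -v k).symm i) (Fin.le_def.2 (by omega))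
  linarith

lemma le_gap_of_separates {m : ℕ} (hm : 1 ≤ m) (hmK : m < K) {v : Fin K → ℝ} {c : ℝ}
    (hc : 0 < c) {A : Finset (Fin K)} (hA : A.card = m) (hsep : Separates v c A) :
    c ≤ decreasing v ⟨m - 1, by omega⟩ - decreasing v ⟨m, hmK⟩ := by
  have hmem : ∀ k, k ∈ A ↔ (((Tuple.sort fun k => -v k).symm k : Fin K) : ℕ) < m := fun k => by
    rw [← topSet_eq_of_separates hmK hc hA hsep, mem_topSet]
  refine hsep _ ?_ _ ?_
  · rw [hmem, Equiv.symm_apply_apply]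
    simp only
    omega
  · rw [hmem, Equiv.symm_apply_apply]
    simp

lemma le_gap_iff_exists_separates {m : ℕ} (hm : 1 ≤ m) (hmK : m < K) {v : Fin K → ℝ} {c : ℝ}
    (hc : 0 < c) :
    c ≤ decreasing v ⟨m - 1, by omega⟩ - decreasing v ⟨m, hmK⟩
      ↔ ∃ A : Finset (Fin K), A.card = m ∧ Separates v c A :=
  ⟨fun h => ⟨_, card_topSet hmK.le v, separates_topSet hm hmK h⟩,
    fun ⟨_, hA, hsep⟩ => le_gap_of_separates hm hmK hc hA hsep⟩

/-! ### The gap rule -/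

/-- The set declared by the gap rule: the streams with the `m` largest cumulative log-likelihood
ratios at the time of stopping. If the rule never stops, the value at time `0` is used, which is the
same for all paths. -/
noncomputable def gapDecision (S : (k : Fin K) → TestingPair (E k)) (m : ℕ) (hmK : m < K) (c : ℝ)
    (ω : Path E) : Finset (Fin K) :=
  topSet m fun k => cumLLR S k (gapTime S m hmK c ω).toNat ω

lemma gapTime_le_iff (S : (k : Fin K) → TestingPair (E k)) {m : ℕ} (hm : 1 ≤ m) (hmK : m < K)
    {c : ℝ} (hc : 0 < c) (ω : Path E) (n : ℕ) :
    gapTime S m hmK c ω ≤ n ↔ ∃ l ≤ n, 1 ≤ l ∧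
      ∃ A : Finset (Fin K), A.card = m ∧ Separates (fun k => cumLLR S k l ω) c A := by
  have h : gapTime S m hmK c ω ≤ n ↔ gapTime S m hmK c ω < (n : ℕ∞) + 1 :=
    (ENat.lt_add_one_iff (ENat.natCast_ne_top n)).symm
  rw [h, gapTime]
  simp only [iInf_lt_iff, ← le_gap_iff_exists_separates hm hmK hc]
  constructor
  · rintro ⟨l, ⟨h1, hgap⟩, hl⟩
    refine ⟨l, ?_, h1, hgap⟩
    exact Nat.lt_succ_iff.1 (by exact_mod_cast hl)
  · rintro ⟨l, hl, h1, hgap⟩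
    refine ⟨l, ⟨h1, hgap⟩, ?_⟩
    exact_mod_cast Nat.lt_succ_iff.2 hl

lemma exists_separates_of_gapTime_eq (S : (k : Fin K) → TestingPair (E k)) {m : ℕ} (hm : 1 ≤ m)
    (hmK : m < K) {c : ℝ} (hc : 0 < c) {ω : Path E} {n : ℕ} (h : gapTime S m hmK c ω = n) :
    ∃ A : Finset (Fin K), A.card = m ∧ Separates (fun k => cumLLR S k n ω) c A := by
  obtain ⟨l, hl, h1, hsep⟩ := (gapTime_le_iff S hm hmK hc ω n).1 h.le
  have hnl : n ≤ l := by
    have := (gapTime_le_iff S hm hmK hc ω l).2 ⟨l, le_rfl, h1, hsep⟩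
    rw [h] at this
    exact_mod_cast this
  rwa [le_antisymm hnl hl]

lemma measurableSet_separates (S : (k : Fin K) → TestingPair (E k)) (c : ℝ) (n : ℕ)
    (A : Finset (Fin K)) :
    MeasurableSet[obsFiltration E n] {ω | Separates (fun k => cumLLR S k n ω) c A} := by
  have : {ω : Path E | Separates (fun k => cumLLR S k n ω) c A}
      = ⋂ i ∈ A, ⋂ j ∈ (Aᶜ : Finset (Fin K)), {ω | c ≤ cumLLR S i n ω - cumLLR S j n ω} := by
    ext ω
    simp [Separates]
  rw [this]
  refine Finset.measurableSet_biInter _ fun i _ => Finset.measurableSet_biInter _ fun j _ => ?_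
  exact ((measurable_cumLLR S i n).sub (measurable_cumLLR S j n)) measurableSet_Ici

lemma isStoppingTime_gapTime (S : (k : Fin K) → TestingPair (E k)) {m : ℕ} (hm : 1 ≤ m)
    (hmK : m < K) {c : ℝ} (hc : 0 < c) :
    IsStoppingTime (obsFiltration E) (gapTime S m hmK c) := by
  intro n
  have : {ω : Path E | gapTime S m hmK c ω ≤ n} = ⋃ l ∈ Finset.Icc 1 n,
      ⋃ A ∈ (Finset.univ.filter fun A : Finset (Fin K) => A.card = m),
        {ω | Separates (fun k => cumLLR S k l ω) c A} := by
    ext ω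
    rw [Set.mem_ofPred_eq, gapTime_le_iff S hm hmK hc]
    simp only [Set.mem_iUnion, Finset.mem_Icc, Finset.mem_filter, Finset.mem_univ, true_and,
      Set.mem_ofPred_eq, exists_prop]
    exact ⟨fun ⟨l, h1, h2, h3⟩ => ⟨l, ⟨h2, h1⟩, h3⟩, fun ⟨l, ⟨h2, h1⟩, h3⟩ => ⟨l, h1, h2, h3⟩⟩
  refine (this ▸ ?_ : MeasurableSet[obsFiltration E n] {ω : Path E | gapTime S m hmK c ω ≤ n})
  refine Finset.measurableSet_biUnion _ fun l hl => Finset.measurableSet_biUnion _ fun A _ => ?_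
  exact (obsFiltration E).mono (Finset.mem_Icc.1 hl).2 _ (measurableSet_separates S c l A)

lemma isSequentialTest_gap (S : (k : Fin K) → TestingPair (E k)) {m : ℕ} (hm : 1 ≤ m)
    (hmK : m < K) {c : ℝ} (hc : 0 < c) :
    IsSequentialTest (gapTime S m hmK c) (gapDecision S m hmK c) := by
  refine ⟨fun ω => le_iInf₂ fun n hn => by exact_mod_cast hn.1,
    isStoppingTime_gapTime S hm hmK hc, fun k => ?_⟩
  set hT := isStoppingTime_gapTime S hm hmK hc
  have hn : ∀ n : ℕ, MeasurableSet[hT.measurableSpace]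
      ({ω : Path E | k ∈ gapDecision S m hmK c ω} ∩ {ω | gapTime S m hmK c ω = n}) := by
    intro n
    refine (hT.measurableSet_inter_eq_iff _ n).2 ?_
    have heq : {ω : Path E | k ∈ gapDecision S m hmK c ω} ∩ {ω | gapTime S m hmK c ω = n}
        = (⋃ A ∈ (Finset.univ.filter fun A : Finset (Fin K) => A.card = m ∧ k ∈ A),
          {ω | Separates (fun k => cumLLR S k n ω) c A}) ∩ {ω | gapTime S m hmK c ω = n} := by
      ext ω
      simp only [Set.mem_inter_iff, Set.mem_ofPred_eq, Set.mem_iUnion, Finset.mem_filter,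
        Finset.mem_univ, true_and, exists_prop]
      refine and_congr_left fun hω => ?_
      obtain ⟨A, hA, hsep⟩ := exists_separates_of_gapTime_eq S hm hmK hc hω
      have hdA : gapDecision S m hmK c ω = A := by
        rw [gapDecision, hω, ENat.toNat_natCast]
        exact topSet_eq_of_separates hmK hc hA hsep
      constructor
      · exact fun hk => ⟨A, ⟨hA, hdA ▸ hk⟩, hsep⟩
      · rintro ⟨B, ⟨hB, hkB⟩, hsepB⟩
        rw [gapDecision, hω, ENat.toNat_natCast, topSet_eq_of_separates hmK hc hB hsepB]
        exact hkB
    refine (heq ▸ ?_ : MeasurableSet[obsFiltration E n]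
      ({ω : Path E | k ∈ gapDecision S m hmK c ω} ∩ {ω | gapTime S m hmK c ω = n}))
    exact (Finset.measurableSet_biUnion _ fun A _ => measurableSet_separates S c n A).inter
      (hT.measurableSet_eq n)
  have htop : MeasurableSet[hT.measurableSpace]
      ({ω : Path E | k ∈ gapDecision S m hmK c ω} ∩ {ω | gapTime S m hmK c ω = ⊤}) := by
    have hT_top : MeasurableSet[hT.measurableSpace] {ω : Path E | gapTime S m hmK c ω = ⊤} := by
      have : {ω : Path E | gapTime S m hmK c ω = ⊤}
          = (⋃ n : ℕ, {ω | gapTime S m hmK c ω = n})ᶜ := by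
        ext ω
        simp only [Set.mem_ofPred_eq, Set.mem_compl_iff, Set.mem_iUnion]
        rw [← not_iff_not, not_not, ← ne_eq, ENat.ne_top_iff_exists]
        simp [eq_comm]
      rw [this]
      exact (MeasurableSet.iUnion fun n => hT.measurableSet_eq' n).compl
    have heq : {ω : Path E | k ∈ gapDecision S m hmK c ω} ∩ {ω | gapTime S m hmK c ω = ⊤}
        = {_ω | k ∈ topSet m fun _ : Fin K => (0 : ℝ)} ∩ {ω | gapTime S m hmK c ω = ⊤} := by
      ext ω
      simp only [Set.mem_inter_iff, Set.mem_ofPred_eq]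
      refine and_congr_left fun hω => ?_
      simp [gapDecision, hω, cumLLR]
    rw [heq]
    exact (MeasurableSet.const _).inter hT_top
  have hunion : {ω : Path E | k ∈ gapDecision S m hmK c ω}
      = ({ω : Path E | k ∈ gapDecision S m hmK c ω} ∩ {ω | gapTime S m hmK c ω = ⊤})
        ∪ ⋃ n : ℕ, ({ω : Path E | k ∈ gapDecision S m hmK c ω}
          ∩ {ω | gapTime S m hmK c ω = n}) := by
    rw [← Set.inter_iUnion, ← Set.inter_union_distrib_left, eq_comm, Set.inter_eq_left]
    intro ω _
    rcases eq_or_ne (gapTime S m hmK c ω) ⊤ with h | h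
    · exact Or.inl h
    · obtain ⟨n, hn⟩ := ENat.ne_top_iff_exists.1 h
      exact Or.inr (Set.mem_iUnion.2 ⟨n, hn.symm⟩)
  rw [hunion]
  exact htop.union (MeasurableSet.iUnion hn)

/-- A wrong decision at a finite time needs a noise stream `j` whose cumulative log-likelihood ratio
exceeds that of a signal `i` by `c`. By the change of measure to the law in which `i` and `j` are
exchanged, each of the `m (K - m)` pairs contributes at most `exp (-c)`. -/
lemma prob_gapDecision_ne_le (S : (k : Fin K) → TestingPair (E k))
    (hac : ∀ k, (S k).MutuallyAC) {m : ℕ} (hm : 1 ≤ m) (hmK : m < K) {c : ℝ} (hc : 0 < c)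
    {A : Finset (Fin K)} (hA : A ∈ exactly K m)
    (hfin : ∀ᵐ ω ∂prob S A, gapTime S m hmK c ω ≠ ⊤) :
    prob S A {ω | gapDecision S m hmK c ω ≠ A}
      ≤ ENNReal.ofReal ((m : ℝ) * ((K : ℝ) - m) * Real.exp (-c)) := by
  have hT := isStoppingTime_gapTime S hm hmK hc
  have hA' : A.card = m := hA
  set R : Fin K → Fin K → Set (Path E) := fun i j => ⋃ n : ℕ, {ω | gapTime S m hmK c ω = n} ∩
    {ω | logLR S A (insert j (A.erase i)) n ω ≤ -c}
  have hR : ∀ i j, prob S A (R i j) ≤ ENNReal.ofReal (Real.exp (-c)) := by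
    intro i j
    refine (prob_iUnion_inter_logLR_le S hac A (insert j (A.erase i))
      (fun n => hT.measurableSet_eq n) ?_ (-c)).trans (mul_le_of_le_one_right' prob_le_one)
    intro a b hab
    refine Set.disjoint_left.2 fun ω (h1 : _ = (a : ℕ∞)) (h2 : _ = (b : ℕ∞)) => hab ?_
    exact_mod_cast h1.symm.trans h2
  have hsub : {ω | gapDecision S m hmK c ω ≠ A}
      ⊆ {ω | ¬ gapTime S m hmK c ω ≠ ⊤} ∪ ⋃ i ∈ A, ⋃ j ∈ Aᶜ, R i j := by
    intro ω hω
    by_cases h : gapTime S m hmK c ω = ⊤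
    · exact Or.inl (not_not.2 h)
    right
    obtain ⟨n, hn⟩ := ENat.ne_top_iff_exists.1 h
    obtain ⟨B, hB, hsep⟩ := exists_separates_of_gapTime_eq S hm hmK hc hn.symm
    have hdB : gapDecision S m hmK c ω = B := by
      rw [gapDecision, ← hn, ENat.toNat_natCast]
      exact topSet_eq_of_separates hmK hc hB hsep
    have hne : B ≠ A := hdB ▸ hω
    obtain ⟨j, hjB, hjA⟩ := exists_mem_notMem_of_card_eq (hB.trans hA'.symm) hne
    obtain ⟨i, hiA, hiB⟩ := exists_mem_notMem_of_card_eq (hA'.trans hB.symm) hne.symm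
    simp only [Set.mem_iUnion]
    refine ⟨i, hiA, j, Finset.mem_compl.2 hjA, Set.mem_iUnion.2 ⟨n, hn.symm, ?_⟩⟩
    rw [Set.mem_ofPred_eq, logLR_exchange S hiA hjA]
    linarith [hsep j hjB i hiB]
  calc prob S A {ω | gapDecision S m hmK c ω ≠ A}
      ≤ prob S A {ω | ¬ gapTime S m hmK c ω ≠ ⊤} + prob S A (⋃ i ∈ A, ⋃ j ∈ Aᶜ, R i j) :=
        (measure_mono hsub).trans (measure_union_le _ _)
    _ = prob S A (⋃ i ∈ A, ⋃ j ∈ Aᶜ, R i j) := by rw [ae_iff.1 hfin, zero_add]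
    _ ≤ ∑ i ∈ A, ∑ j ∈ Aᶜ, prob S A (R i j) :=
        (measure_biUnion_finset_le _ _).trans
          (Finset.sum_le_sum fun i _ => measure_biUnion_finset_le _ _)
    _ ≤ ∑ i ∈ A, ∑ j ∈ Aᶜ, ENNReal.ofReal (Real.exp (-c)) :=
        Finset.sum_le_sum fun i _ => Finset.sum_le_sum fun j _ => hR i j
    _ = ENNReal.ofReal ((m : ℝ) * ((K : ℝ) - m) * Real.exp (-c)) := by
        simp only [Finset.sum_const, Finset.card_compl, Fintype.card_fin, hA', nsmul_eq_mul]
        rw [← mul_assoc, ← Nat.cast_mul, ENNReal.ofReal_mul' (Real.exp_pos _).le,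
          ← ENNReal.ofReal_natCast]
        push_cast [Nat.cast_sub hmK.le]
        rfl

/-! ### The expected time of the gap rule -/

lemma toENNReal_eq_tsum_indicator {Ω : Type*} (T : Ω → ℕ∞) (ω : Ω) :
    (T ω : ℝ≥0∞) = ∑' n : ℕ, {ω | (n : ℕ∞) < T ω}.indicator (fun _ => 1) ω := by
  rcases eq_or_ne (T ω) ⊤ with h | h
  · simp [h]
  · obtain ⟨k, hk⟩ := ENat.ne_top_iff_exists.1 h
    rw [tsum_eq_sum (s := Finset.range k) (fun n hn => Set.indicator_of_notMem
        (by simpa [← hk] using hn) _),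
      Finset.sum_congr rfl fun n hn => Set.indicator_of_mem (by simpa [← hk] using hn) _]
    simp [← hk]

lemma measurableSet_lt_of_isStoppingTime {T : Path E → ℕ∞}
    (hT : IsStoppingTime (obsFiltration E) T) (n : ℕ) : MeasurableSet {ω | (n : ℕ∞) < T ω} :=
  (obsFiltration E).le n _ (hT.measurableSet_gt n)

lemma measurable_toENNReal_of_isStoppingTime {T : Path E → ℕ∞}
    (hT : IsStoppingTime (obsFiltration E) T) : Measurable fun ω => (T ω : ℝ≥0∞) := by
  rw [funext (toENNReal_eq_tsum_indicator T)]
  exact Measurable.tsum fun n =>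
    measurable_const.indicator (measurableSet_lt_of_isStoppingTime hT n)

lemma expTime_eq_tsum (S : (k : Fin K) → TestingPair (E k)) (A : Finset (Fin K))
    {T : Path E → ℕ∞} (hT : IsStoppingTime (obsFiltration E) T) :
    expTime S A T = ∑' n : ℕ, prob S A {ω | (n : ℕ∞) < T ω} := by
  have hm := measurableSet_lt_of_isStoppingTime hT
  rw [expTime, lintegral_congr (toENNReal_eq_tsum_indicator T), lintegral_tsum fun n =>
    (measurable_const.indicator (hm n)).aemeasurable]
  exact tsum_congr fun n => by rw [lintegral_indicator_const (hm n), one_mul]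

/-- If every stream collects its share of evidence, in proportion to the weights `e₁` (signals) and
`e₀` (noise), then the gap rule has stopped. -/
lemma setOf_lt_gapTime_subset (S : (k : Fin K) → TestingPair (E k)) {m : ℕ} (hm : 1 ≤ m)
    (hmK : m < K) {A : Finset (Fin K)} (hA : A ∈ exactly K m) {e₁ e₀ c : ℝ} (he : 0 < e₁ + e₀)
    (hc : 0 < c) {n : ℕ} (hn : 1 ≤ n) :
    {ω | (n : ℕ∞) < gapTime S m hmK c ω}
      ⊆ ⋃ k, {ω | cumEvidence S A k n ω < c / (e₁ + e₀) * if k ∈ A then e₁ else e₀} := by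
  intro ω (hω : (n : ℕ∞) < _)
  by_contra h
  simp only [Set.mem_iUnion, Set.mem_ofPred_eq, not_exists, not_lt] at h
  refine hω.not_ge ((gapTime_le_iff S hm hmK hc ω n).2 ⟨n, le_rfl, hn, A, hA, fun i hi j hj => ?_⟩)
  have h1 := h i
  have h2 := h j
  rw [cumEvidence_of_mem S hi, if_pos hi] at h1
  rw [cumEvidence_of_notMem S hj, if_neg hj] at h2
  have h3 : c / (e₁ + e₀) * e₁ + c / (e₁ + e₀) * e₀ = c := by
    field_simp
  linarith

/-- The expected time of the gap rule, up to a constant that does not depend on the threshold. The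
probability of not having stopped decays geometrically from the time `c / (ρ (e₁ + e₀))` on. -/
lemma exists_expTime_gapTime_le (S : (k : Fin K) → TestingPair (E k))
    (hac : ∀ k, (S k).MutuallyAC) (hkl : ∀ k, (S k).KLFinitePos) {m : ℕ} (hm : 1 ≤ m)
    (hmK : m < K) {A : Finset (Fin K)} (hA : A ∈ exactly K m) {e₁ e₀ ρ : ℝ} (he₁ : 0 < e₁)
    (he₀ : 0 < e₀) (hD1 : ∀ k ∈ A, e₁ ≤ (S k).D1) (hD0 : ∀ k ∉ A, e₀ ≤ (S k).D0)
    (hρ0 : 0 < ρ) (hρ1 : ρ < 1) :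
    ∃ M : ℝ, ∀ c : ℝ, 0 < c →
      expTime S A (gapTime S m hmK c) ≤ ENNReal.ofReal (c / (ρ * (e₁ + e₀)) + M) := by
  set w : Fin K → ℝ := fun k => if k ∈ A then e₁ else e₀ with hw
  have hw0 : ∀ k, 0 < w k := fun k => by simp only [hw]; split_ifs <;> assumption
  have hwkl : ∀ k, ρ * w k < (S k).kl (hypothesis A k) := by
    intro k
    have hle : w k ≤ (S k).kl (hypothesis A k) := by
      by_cases hk : k ∈ A
      · simpa [hw, hypothesis, TestingPair.kl, hk] using hD1 k hk
      · simpa [hw, hypothesis, TestingPair.kl, hk] using hD0 k hk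
    nlinarith [hw0 k]
  choose s hs htail using fun k =>
    exists_prob_cumEvidence_lt_le S hac hkl A k (hwkl k)
  set q : Fin K → ℝ≥0∞ := fun k => ENNReal.ofReal (Real.exp (-(s k * ρ * w k))) with hq
  have hq1 : ∀ k, q k < 1 := fun k => by
    rw [hq, ENNReal.ofReal_lt_one, Real.exp_lt_one_iff, neg_lt_zero]
    have := hs k
    have := hw0 k
    positivity
  set M : ℝ≥0∞ := 2 + ∑ k, (1 - q k)⁻¹ with hM
  have hMtop : M ≠ ⊤ := by
    refine ENNReal.add_ne_top.2 ⟨by simp, ENNReal.sum_ne_top.2 fun k _ => ?_⟩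
    exact ENNReal.inv_ne_top.2 (tsub_pos_of_lt (hq1 k)).ne'
  refine ⟨M.toReal, fun c hc => ?_⟩
  have hD : 0 < e₁ + e₀ := by positivity
  have hN0 : 0 ≤ c / (ρ * (e₁ + e₀)) := by positivity
  set N : ℕ := ⌈c / (ρ * (e₁ + e₀))⌉₊ with hN
  have hNc : c / (e₁ + e₀) ≤ ρ * N := by
    have := Nat.le_ceil (c / (ρ * (e₁ + e₀)))
    rw [← hN, div_le_iff₀ (by positivity)] at this
    rw [div_le_iff₀ hD]
    linarith
  have hstep : ∀ r : ℕ, prob S A {ω | ((r + (N + 1) : ℕ) : ℕ∞) < gapTime S m hmK c ω}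
      ≤ ∑ k, q k ^ r := by
    intro r
    refine (measure_mono (setOf_lt_gapTime_subset S hm hmK hA hD hc (by omega))).trans
      ((measure_iUnion_fintype_le _ _).trans (Finset.sum_le_sum fun k _ => ?_))
    refine (htail k _ _).trans ?_
    rw [hq, ← ENNReal.ofReal_pow (Real.exp_pos _).le, ← Real.exp_nat_mul]
    refine ENNReal.ofReal_le_ofReal (Real.exp_le_exp.2 ?_)
    have h1 : c / (e₁ + e₀) * w k ≤ ρ * N * w k := mul_le_mul_of_nonneg_right hNc (hw0 k).le
    have h2 : s k * (c / (e₁ + e₀) * w k - ((r + (N + 1) : ℕ) : ℝ) * (ρ * w k))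
        ≤ s k * (-(r : ℝ) * (ρ * w k)) := by
      refine mul_le_mul_of_nonneg_left ?_ (hs k).le
      push_cast
      nlinarith [mul_pos hρ0 (hw0 k)]
    calc _ ≤ s k * (-(r : ℝ) * (ρ * w k)) := h2
      _ = _ := by ring
  rw [expTime_eq_tsum S A (isStoppingTime_gapTime S hm hmK hc),
    ← ENNReal.summable.sum_add_tsum_nat_add' (k := N + 1)]
  have hhead : ∑ n ∈ Finset.range (N + 1), prob S A {ω | (n : ℕ∞) < gapTime S m hmK c ω}
      ≤ ENNReal.ofReal (c / (ρ * (e₁ + e₀))) + 2 := by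
    calc _ ≤ ∑ n ∈ Finset.range (N + 1), (1 : ℝ≥0∞) := Finset.sum_le_sum fun n _ => prob_le_one
      _ = ENNReal.ofReal ((N + 1 : ℕ) : ℝ) := by
        rw [ENNReal.ofReal_natCast]
        simp
      _ ≤ ENNReal.ofReal (c / (ρ * (e₁ + e₀)) + 2) := by
        refine ENNReal.ofReal_le_ofReal ?_
        have := Nat.ceil_lt_add_one hN0
        push_cast
        linarith
      _ = _ := by rw [ENNReal.ofReal_add hN0 zero_le_two]; simp
  have htailsum : ∑' r : ℕ, prob S A {ω | ((r + (N + 1) : ℕ) : ℕ∞) < gapTime S m hmK c ω}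
      ≤ ∑ k, (1 - q k)⁻¹ := by
    calc _ ≤ ∑' r : ℕ, ∑ k, q k ^ r := ENNReal.tsum_le_tsum hstep
      _ = ∑ k, ∑' r : ℕ, q k ^ r := Summable.tsum_finsetSum fun _ _ => ENNReal.summable
      _ = _ := by simp only [ENNReal.tsum_geometric]
  calc _ ≤ (ENNReal.ofReal (c / (ρ * (e₁ + e₀))) + 2) + ∑ k, (1 - q k)⁻¹ :=
        add_le_add hhead htailsum
    _ = ENNReal.ofReal (c / (ρ * (e₁ + e₀))) + M := by rw [hM, add_assoc]
    _ = _ := by rw [ENNReal.ofReal_add hN0 ENNReal.toReal_nonneg, ENNReal.ofReal_toReal hMtop]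

/-! ### Admissibility of the gap rule -/

lemma exists_eta1_eq (S : (k : Fin K) → TestingPair (E k)) {A : Finset (Fin K)}
    (hA : A.Nonempty) :
    ∃ i ∈ A, eta1 S A = ENNReal.ofReal (S i).D1 ∧ ∀ k ∈ A, (S i).D1 ≤ (S k).D1 := by
  obtain ⟨i, hi, hmin⟩ := A.exists_min_image (fun k => (S k).D1) hA
  exact ⟨i, hi, le_antisymm (iInf₂_le i hi)
    (le_iInf₂ fun k hk => ENNReal.ofReal_le_ofReal (hmin k hk)), hmin⟩

lemma exists_eta0_eq (S : (k : Fin K) → TestingPair (E k)) {A : Finset (Fin K)}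
    (hA : Aᶜ.Nonempty) :
    ∃ j ∉ A, eta0 S A = ENNReal.ofReal (S j).D0 ∧ ∀ k ∉ A, (S j).D0 ≤ (S k).D0 := by
  obtain ⟨j, hj, hmin⟩ := Aᶜ.exists_min_image (fun k => (S k).D0) hA
  exact ⟨j, Finset.mem_compl.1 hj, le_antisymm (iInf₂_le j hj)
    (le_iInf₂ fun k hk => ENNReal.ofReal_le_ofReal (hmin k hk)),
    fun k hk => hmin k (Finset.mem_compl.2 hk)⟩

lemma nonempty_of_mem_exactly {m : ℕ} (hm : 1 ≤ m) {A : Finset (Fin K)}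
    (hA : A ∈ exactly K m) : A.Nonempty :=
  Finset.card_pos.1 (hm.trans_eq (Eq.symm hA))

lemma compl_nonempty_of_mem_exactly {m : ℕ} (hmK : m < K) {A : Finset (Fin K)}
    (hA : A ∈ exactly K m) : Aᶜ.Nonempty := by
  have hA' : A.card = m := hA
  rw [← Finset.card_pos, Finset.card_compl, Fintype.card_fin, hA']
  omega

lemma ae_gapTime_ne_top (S : (k : Fin K) → TestingPair (E k))
    (hac : ∀ k, (S k).MutuallyAC) (hkl : ∀ k, (S k).KLFinitePos) {m : ℕ} (hm : 1 ≤ m)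
    (hmK : m < K) {A : Finset (Fin K)} (hA : A ∈ exactly K m) {c : ℝ} (hc : 0 < c) :
    ∀ᵐ ω ∂prob S A, gapTime S m hmK c ω ≠ ⊤ := by
  obtain ⟨i, -, -, hi⟩ := exists_eta1_eq S (nonempty_of_mem_exactly hm hA)
  obtain ⟨j, -, -, hj⟩ := exists_eta0_eq S (compl_nonempty_of_mem_exactly hmK hA)
  obtain ⟨M, hM⟩ := exists_expTime_gapTime_le S hac hkl hm hmK hA (hkl i).2.2 (hkl j).1.2 hi hj
    one_half_pos one_half_lt_one
  have hmeas := measurable_toENNReal_of_isStoppingTime (isStoppingTime_gapTime S hm hmK hc)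
  filter_upwards [ae_lt_top hmeas ((hM c hc).trans_lt ENNReal.ofReal_lt_top).ne] with ω hω h
  simp [h] at hω

lemma gapThreshold_eq {m : ℕ} {α β : ℝ} (hα : 0 < α) (hβ : 0 < β) (hα1 : α < 1) :
    gapThreshold K m α β
      = -Real.log (min α β) + Real.log ((m : ℝ) * ((K : ℝ) - (m : ℝ))) := by
  rw [gapThreshold, abs_of_neg (Real.log_neg (lt_min hα hβ) ((min_le_left _ _).trans_lt hα1))]

lemma one_le_mul_sub {m : ℕ} (hm : 1 ≤ m) (hmK : m < K) : 1 ≤ (m : ℝ) * ((K : ℝ) - (m : ℝ)) := by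
  have h1 : (1 : ℝ) ≤ m := by exact_mod_cast hm
  have h2 : (m : ℝ) + 1 ≤ K := by exact_mod_cast hmK
  nlinarith

lemma gapThreshold_pos {m : ℕ} (hm : 1 ≤ m) (hmK : m < K) {α β : ℝ} (hα : 0 < α) (hβ : 0 < β)
    (hα1 : α < 1) : 0 < gapThreshold K m α β := by
  rw [gapThreshold_eq hα hβ hα1]
  have h1 := Real.log_neg (lt_min hα hβ) ((min_le_left _ _).trans_lt hα1)
  have h2 := Real.log_nonneg (one_le_mul_sub hm hmK)
  linarith

lemma gap_mem_admissibleExactly (S : (k : Fin K) → TestingPair (E k))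
    (hac : ∀ k, (S k).MutuallyAC) (hkl : ∀ k, (S k).KLFinitePos) {m : ℕ} (hm : 1 ≤ m)
    (hmK : m < K) {α β : ℝ} (hα : 0 < α) (hβ : 0 < β) (hα1 : α < 1) :
    (gapTime S m hmK (gapThreshold K m α β), gapDecision S m hmK (gapThreshold K m α β))
      ∈ admissibleExactly S m α β := by
  have hc := gapThreshold_pos hm hmK hα hβ hα1
  refine ⟨isSequentialTest_gap S hm hmK hc, fun ω => card_topSet hmK.le _, fun A hA => ?_⟩
  refine (prob_gapDecision_ne_le S hac hm hmK hc hA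
    (ae_gapTime_ne_top S hac hkl hm hmK hA hc)).trans (ENNReal.ofReal_le_ofReal (le_of_eq ?_))
  have h0 := zero_lt_one.trans_le (one_le_mul_sub hm hmK)
  rw [gapThreshold_eq hα hβ hα1, neg_add, neg_neg, Real.exp_add, Real.exp_neg, Real.exp_log h0,
    Real.exp_log (lt_min hα hβ), mul_comm (min α β), mul_inv_cancel_left₀ h0.ne']

lemma admissibleExactly_subset (S : (k : Fin K) → TestingPair (E k)) (m : ℕ) (α β : ℝ) :
    admissibleExactly S m α β ⊆ admissible S (exactly K m) α β := by
  rintro ⟨T, d⟩ ⟨htest, -, herr⟩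
  refine ⟨htest, fun A hA => ⟨?_, ?_⟩⟩
  · refine (measure_mono ?_).trans
      ((herr A hA).trans (ENNReal.ofReal_le_ofReal (min_le_left _ _)))
    intro ω (hω : (d ω \ A).Nonempty) (h : d ω = A)
    simp [h] at hω
  · refine (measure_mono ?_).trans
      ((herr A hA).trans (ENNReal.ofReal_le_ofReal (min_le_right _ _)))
    intro ω (hω : (A \ d ω).Nonempty) (h : d ω = A)
    simp [h] at hω

/-! ### The lower bound for arbitrary tests -/

lemma eventually_forall_le_mul {u : ℕ → ℝ} {D b : ℝ}
    (hu : Tendsto (fun n : ℕ => u n / n) atTop (𝓝 D)) (hb0 : 0 < b) (hb : D < b) :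
    ∀ᶠ N : ℕ in atTop, ∀ n ≤ N, u n ≤ b * N := by
  obtain ⟨n₀, hn₀⟩ := eventually_atTop.1 (hu.eventually (gt_mem_nhds hb))
  have hsmall : ∀ᶠ N : ℕ in atTop, ∀ n ∈ Finset.range (n₀ + 1), u n ≤ b * N :=
    (Filter.eventually_all_finset _).2 fun n _ =>
      (tendsto_natCast_atTop_atTop.const_mul_atTop hb0).eventually_ge_atTop (u n)
  filter_upwards [hsmall] with N hN n hnN
  rcases Nat.lt_or_ge n (n₀ + 1) with h | h
  · exact hN n (Finset.mem_range.2 h)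
  · have hn : (0 : ℝ) < n := by exact_mod_cast (Nat.succ_pos n₀).trans_le h
    have h1 := hn₀ n (by omega)
    rw [div_lt_iff₀ hn] at h1
    have h2 : (n : ℝ) ≤ N := by exact_mod_cast hnN
    nlinarith

/-- By the strong law, up to time `N` the log-likelihood ratio stays below `b N` with high
probability, for each `b` above its drift. -/
lemma tendsto_prob_exists_logLR_gt (S : (k : Fin K) → TestingPair (E k))
    (hkl : ∀ k, (S k).KLFinitePos) {A : Finset (Fin K)} {i j : Fin K} (hi : i ∈ A) (hj : j ∉ A)
    {b : ℝ} (hb : (S i).D1 + (S j).D0 < b) :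
    Tendsto (fun N : ℕ => prob S A {ω | ∃ n ≤ N, b * N < logLR S A (insert j (A.erase i)) n ω})
      atTop (𝓝 0) := by
  have hD1 := (hkl i).2.2
  have hD0 := (hkl j).1.2
  have hmeas : ∀ N : ℕ, MeasurableSet
      {ω : Path E | ∃ n ≤ N, b * N < logLR S A (insert j (A.erase i)) n ω} := by
    intro N
    have : {ω : Path E | ∃ n ≤ N, b * N < logLR S A (insert j (A.erase i)) n ω}
        = ⋃ n ∈ Finset.range (N + 1), {ω | b * N < logLR S A (insert j (A.erase i)) n ω} := by
      ext ω
      simp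
    rw [this]
    exact Finset.measurableSet_biUnion _ fun n _ =>
      (obsFiltration E).le n _ (measurable_logLR S A _ n measurableSet_Ioi)
  rw [← measure_empty (μ := prob S A)]
  refine tendsto_measure_of_ae_tendsto_indicator_of_isFiniteMeasure atTop MeasurableSet.empty
    hmeas ?_
  filter_upwards [ae_tendsto_cumEvidence_div S hkl A i, ae_tendsto_cumEvidence_div S hkl A j]
    with ω h1 h2
  have h3 : Tendsto (fun n : ℕ => logLR S A (insert j (A.erase i)) n ω / n) atTop
      (𝓝 ((S i).D1 + (S j).D0)) := by
    have h := h1.add h2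
    simp only [hypothesis, hi, hj, TestingPair.kl, if_true, if_false, zero_ne_one] at h
    refine h.congr fun n => ?_
    rw [logLR_exchange S hi hj, cumEvidence_of_mem S hi, cumEvidence_of_notMem S hj]
    ring
  filter_upwards [eventually_forall_le_mul h3 (by linarith) hb] with N hN
  simp only [Set.mem_empty_iff_false, iff_false, not_exists, not_and, not_lt]
  exact hN

/-- A test that stops by time `N` either decides in a way that is unlikely under `P_A`, or sees a
log-likelihood ratio above `x`, or decides in a way whose probability is at most `exp x` times the
one under `P_C`. -/
lemma prob_le_of_isStoppingTime (S : (k : Fin K) → TestingPair (E k))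
    (hac : ∀ k, (S k).MutuallyAC) (A C : Finset (Fin K)) {T : Path E → ℕ∞}
    (hT : IsStoppingTime (obsFiltration E) T) {G : Set (Path E)}
    (hG : MeasurableSet[hT.measurableSpace] G) (N : ℕ) (x : ℝ) :
    prob S A {ω | T ω ≤ N}
      ≤ prob S A Gᶜ + prob S A {ω | ∃ n ≤ N, x < logLR S A C n ω}
        + ENNReal.ofReal (Real.exp x) * prob S C G := by
  set B : ℕ → Set (Path E) := fun n => G ∩ {ω | T ω = n}
  have hB : ∀ n, MeasurableSet[obsFiltration E n] (B n) := fun n =>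
    (hT.measurableSet_inter_eq_iff G n).1 (hG.inter (hT.measurableSet_eq' n))
  have hdisj : Pairwise (Function.onFun Disjoint B) := by
    intro a b hab
    refine Set.disjoint_left.2 fun ω h1 h2 => hab ?_
    exact_mod_cast (h1.2 : T ω = a).symm.trans h2.2
  have hsub : {ω | T ω ≤ N} ⊆ (Gᶜ ∪ {ω | ∃ n ≤ N, x < logLR S A C n ω})
      ∪ ⋃ n, B n ∩ {ω | logLR S A C n ω ≤ x} := by
    intro ω (hω : T ω ≤ N)
    by_cases hGω : ω ∈ G
    · obtain ⟨n, hn⟩ := ENat.ne_top_iff_exists.1 (ne_top_of_le_ne_top (ENat.natCast_ne_top N) hω)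
      have hnN : n ≤ N := by
        rw [← hn] at hω
        exact_mod_cast hω
      rcases lt_or_ge x (logLR S A C n ω) with h | h
      · exact Or.inl (Or.inr ⟨n, hnN, h⟩)
      · exact Or.inr (Set.mem_iUnion.2 ⟨n, ⟨hGω, hn.symm⟩, h⟩)
    · exact Or.inl (Or.inl hGω)
  refine (measure_mono hsub).trans ((measure_union_le _ _).trans (add_le_add
    (measure_union_le _ _) ?_))
  refine (prob_iUnion_inter_logLR_le S hac A C hB hdisj x).trans ?_
  gcongr
  exact Set.iUnion_subset fun n => Set.inter_subset_left

/-- Every admissible test distinguishes `P_A` from `P_C`, `C` being `A` with the signal `i`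
exchanged for `j`, with the smaller of the two error bounds on the side of `C`. If `α ≤ β` the distinguishing
event is that `i` is declared, otherwise that `j` is not. -/
lemma exists_event_of_mem_admissible (S : (k : Fin K) → TestingPair (E k)) {m : ℕ}
    {A : Finset (Fin K)} (hA : A ∈ exactly K m) {i j : Fin K} (hi : i ∈ A) (hj : j ∉ A)
    {α β : ℝ} {p : (Path E → ℕ∞) × (Path E → Finset (Fin K))}
    (hp : p ∈ admissible S (exactly K m) α β) :
    ∃ (hT : IsStoppingTime (obsFiltration E) p.1) (G : Set (Path E)),
      MeasurableSet[hT.measurableSpace] G ∧ prob S A Gᶜ ≤ ENNReal.ofReal (max α β) ∧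
      prob S (insert j (A.erase i)) G ≤ ENNReal.ofReal (min α β) := by
  obtain ⟨⟨-, hT, hd⟩, herr⟩ := hp
  have hij : i ≠ j := fun h => hj (h ▸ hi)
  have hC := exchange_mem_exactly hA hi hj
  rcases le_total α β with h | h
  · refine ⟨hT, {ω | i ∈ p.2 ω}, hd i, ?_, ?_⟩
    · rw [max_eq_right h]
      exact (measure_mono fun ω hω => show (A \ p.2 ω).Nonempty from
        ⟨i, Finset.mem_sdiff.2 ⟨hi, hω⟩⟩).trans (herr A hA).2
    · rw [min_eq_left h]
      exact (measure_mono fun ω hω => show (p.2 ω \ insert j (A.erase i)).Nonempty from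
        ⟨i, Finset.mem_sdiff.2 ⟨hω, by simp [hij]⟩⟩).trans (herr _ hC).1
  · refine ⟨hT, {ω | j ∈ p.2 ω}ᶜ, (hd j).compl, ?_, ?_⟩
    · rw [max_eq_left h, compl_compl]
      exact (measure_mono fun ω hω => show (p.2 ω \ A).Nonempty from
        ⟨j, Finset.mem_sdiff.2 ⟨hω, hj⟩⟩).trans (herr A hA).1
    · rw [min_eq_right h]
      exact (measure_mono fun ω hω => show (insert j (A.erase i) \ p.2 ω).Nonempty from
        ⟨j, Finset.mem_sdiff.2 ⟨Finset.mem_insert_self _ _, hω⟩⟩).trans (herr _ hC).2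

lemma le_expTime_of_isStoppingTime (S : (k : Fin K) → TestingPair (E k)) (A : Finset (Fin K))
    {T : Path E → ℕ∞} (hT : IsStoppingTime (obsFiltration E) T) (N : ℕ) {r : ℝ≥0∞}
    (hr : prob S A {ω | T ω ≤ N} ≤ r) : ((N + 1 : ℕ) : ℝ≥0∞) * (1 - r) ≤ expTime S A T := by
  have hm := measurableSet_lt_of_isStoppingTime hT N
  have hcompl : {ω : Path E | (N : ℕ∞) < T ω} = {ω | T ω ≤ N}ᶜ := by
    ext ω
    simp
  have hle : MeasurableSet {ω : Path E | T ω ≤ N} := (obsFiltration E).le N _ (hT N)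
  calc ((N + 1 : ℕ) : ℝ≥0∞) * (1 - r)
      ≤ ((N + 1 : ℕ) : ℝ≥0∞) * prob S A {ω | (N : ℕ∞) < T ω} := by
        rw [hcompl, prob_compl_eq_one_sub hle]
        gcongr
    _ = ∫⁻ ω, {ω : Path E | (N : ℕ∞) < T ω}.indicator (fun _ => ((N + 1 : ℕ) : ℝ≥0∞)) ω
          ∂prob S A := (lintegral_indicator_const hm _).symm
    _ ≤ expTime S A T := by
        refine lintegral_mono fun ω => ?_
        by_cases h : (N : ℕ∞) < T ω
        · rw [Set.indicator_of_mem (show ω ∈ {ω : Path E | (N : ℕ∞) < T ω} from h)]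
          have h1 : ((N + 1 : ℕ) : ℕ∞) ≤ T ω := by
            push_cast
            exact Order.add_one_le_of_lt h
          have h2 := ENat.toENNReal_le.2 h1
          simpa only [ENat.toENNReal_coe] using h2
        · rw [Set.indicator_of_notMem (show ω ∉ {ω : Path E | (N : ℕ∞) < T ω} from h)]
          exact zero_le

/-- The filter along which both error bounds tend to `0` from the right, without any
relation between their rates. -/
abbrev errorFilter : Filter (ℝ × ℝ) := 𝓝[>] 0 ×ˢ 𝓝[>] 0

lemma eventually_errorFilter :
    ∀ᶠ p : ℝ × ℝ in errorFilter, (0 < p.1 ∧ p.1 < 1) ∧ (0 < p.2 ∧ p.2 < 1) :=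
  prod_mem_prod (Ioo_mem_nhdsGT zero_lt_one) (Ioo_mem_nhdsGT zero_lt_one)

lemma tendsto_max_errorFilter :
    Tendsto (fun p : ℝ × ℝ => max p.1 p.2) errorFilter (𝓝 0) := by
  have h1 : Tendsto (fun p : ℝ × ℝ => p.1) errorFilter (𝓝 0) :=
    tendsto_fst.mono_right nhdsWithin_le_nhds
  have h2 : Tendsto (fun p : ℝ × ℝ => p.2) errorFilter (𝓝 0) :=
    tendsto_snd.mono_right nhdsWithin_le_nhds
  simpa using h1.max h2

lemma tendsto_abs_log_min_errorFilter :
    Tendsto (fun p : ℝ × ℝ => |Real.log (min p.1 p.2)|) errorFilter atTop := by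
  have h1 : Tendsto (fun p : ℝ × ℝ => p.1) errorFilter (𝓝 0) :=
    tendsto_fst.mono_right nhdsWithin_le_nhds
  have h2 : Tendsto (fun p : ℝ × ℝ => p.2) errorFilter (𝓝 0) :=
    tendsto_snd.mono_right nhdsWithin_le_nhds
  have h : Tendsto (fun p : ℝ × ℝ => min p.1 p.2) errorFilter (𝓝[>] 0) := by
    refine tendsto_nhdsWithin_iff.2 ⟨by simpa using h1.min h2, ?_⟩
    filter_upwards [eventually_errorFilter] with p hp
    exact lt_min hp.1.1 hp.2.1
  exact tendsto_abs_atBot_atTop.comp (Real.tendsto_log_nhdsGT_zero.comp h)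

lemma eventually_le_infTime (S : (k : Fin K) → TestingPair (E k))
    (hac : ∀ k, (S k).MutuallyAC) (hkl : ∀ k, (S k).KLFinitePos) {m : ℕ}
    {A : Finset (Fin K)} (hA : A ∈ exactly K m) {i j : Fin K} (hi : i ∈ A) (hj : j ∉ A)
    {ε : ℝ} (hε : 0 < ε) (hε1 : ε < 1) :
    ∀ᶠ p : ℝ × ℝ in errorFilter,
      ENNReal.ofReal ((1 - ε) * (|Real.log (min p.1 p.2)| / ((S i).D1 + (S j).D0)))
        ≤ infTime S A (admissible S (exactly K m) p.1 p.2) := by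
  have hD1 := (hkl i).2.2
  have hD0 := (hkl j).1.2
  set D := (S i).D1 + (S j).D0 with hDdef
  have hD : 0 < D := by positivity
  -- half of `ε` is spent on the deadline `N`, the other half on the probability of meeting it
  set δ := ε / 2 with hδ
  set L : ℝ × ℝ → ℝ := fun p => |Real.log (min p.1 p.2)| with hL
  set N : ℝ × ℝ → ℕ := fun p => ⌊(1 - δ) * (L p / D)⌋₊ with hN
  set C := insert j (A.erase i)
  set r : ℝ × ℝ → ℝ≥0∞ := fun p => ENNReal.ofReal (max p.1 p.2)
    + prob S A {ω | ∃ n ≤ N p, (1 + δ) * D * N p < logLR S A C n ω}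
    + ENNReal.ofReal (Real.exp (-(δ ^ 2 * L p))) with hr
  have hLtop : Tendsto L errorFilter atTop := tendsto_abs_log_min_errorFilter
  have hNtop : Tendsto N errorFilter atTop := by
    refine tendsto_nat_floor_atTop.comp (Tendsto.const_mul_atTop (by linarith) ?_)
    exact hLtop.atTop_div_const hD
  have hr0 : Tendsto r errorFilter (𝓝 0) := by
    have h1 : Tendsto (fun p : ℝ × ℝ => ENNReal.ofReal (max p.1 p.2)) errorFilter (𝓝 0) := by
      simpa using ENNReal.tendsto_ofReal tendsto_max_errorFilter
    have h2 := (tendsto_prob_exists_logLR_gt S hkl hi hj (b := (1 + δ) * D)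
      (by rw [← hDdef]; nlinarith)).comp hNtop
    have h3 : Tendsto (fun p => ENNReal.ofReal (Real.exp (-(δ ^ 2 * L p)))) errorFilter (𝓝 0) := by
      have : Tendsto (fun p => Real.exp (-(δ ^ 2 * L p))) errorFilter (𝓝 0) :=
        Real.tendsto_exp_neg_atTop_nhds_zero.comp
          (hLtop.const_mul_atTop (by positivity))
      simpa using ENNReal.tendsto_ofReal this
    have h := (h1.add h2).add h3
    rwa [add_zero, add_zero] at h
  have hrδ : ∀ᶠ p in errorFilter, r p < ENNReal.ofReal δ :=
    hr0.eventually (gt_mem_nhds (ENNReal.ofReal_pos.2 (by positivity)))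
  filter_upwards [eventually_errorFilter, hrδ] with p hp hrp
  refine le_iInf₂ fun t ht => ?_
  obtain ⟨hT, G, hG, hGA, hGC⟩ := exists_event_of_mem_admissible S hA hi hj ht
  have hmin : 0 < min p.1 p.2 := lt_min hp.1.1 hp.2.1
  have hLp : L p = -Real.log (min p.1 p.2) :=
    abs_of_neg (Real.log_neg hmin ((min_le_left _ _).trans_lt hp.1.2))
  have hL0 : 0 ≤ L p := abs_nonneg _
  have hNle : D * N p ≤ (1 - δ) * L p := by
    have h := Nat.floor_le (show 0 ≤ (1 - δ) * (L p / D) from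
      mul_nonneg (by linarith) (by positivity))
    calc D * N p ≤ D * ((1 - δ) * (L p / D)) := mul_le_mul_of_nonneg_left h hD.le
      _ = _ := by field_simp
  -- the level `(1 + δ) D N` is at most `(1 - δ²) L`, so that `exp` of it times `α ∧ β` vanishes
  have hdeadline : prob S A {ω | t.1 ω ≤ N p} ≤ r p := by
    refine (prob_le_of_isStoppingTime S hac A C hT hG (N p) ((1 + δ) * D * N p)).trans ?_
    refine add_le_add (add_le_add hGA le_rfl) ?_
    calc _ ≤ ENNReal.ofReal (Real.exp ((1 + δ) * D * N p)) * ENNReal.ofReal (min p.1 p.2) := by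
          gcongr
      _ = ENNReal.ofReal (Real.exp ((1 + δ) * D * N p - L p)) := by
          rw [← ENNReal.ofReal_mul (Real.exp_pos _).le, hLp, sub_neg_eq_add, Real.exp_add,
            Real.exp_log hmin]
      _ ≤ _ := by
          refine ENNReal.ofReal_le_ofReal (Real.exp_le_exp.2 ?_)
          nlinarith
  refine le_trans ?_ (le_expTime_of_isStoppingTime S A hT (N p) hdeadline)
  calc ENNReal.ofReal ((1 - ε) * (L p / D))
      ≤ ENNReal.ofReal (((N p + 1 : ℕ) : ℝ) * (1 - δ)) := by
        refine ENNReal.ofReal_le_ofReal ?_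
        have h := Nat.lt_floor_add_one ((1 - δ) * (L p / D))
        have h' : 0 ≤ L p / D := by positivity
        have h1 : (1 - δ) * (L p / D) * (1 - δ) ≤ ((N p + 1 : ℕ) : ℝ) * (1 - δ) := by
          refine mul_le_mul_of_nonneg_right ?_ (by linarith)
          push_cast
          exact h.le
        have h2 : (1 - ε) * (L p / D) ≤ (1 - δ) * (L p / D) * (1 - δ) := by
          rw [mul_right_comm]
          refine mul_le_mul_of_nonneg_right ?_ h'
          nlinarith [sq_nonneg δ]
        exact h2.trans h1
    _ = ((N p + 1 : ℕ) : ℝ≥0∞) * (1 - ENNReal.ofReal δ) := by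
        rw [ENNReal.ofReal_mul (Nat.cast_nonneg _), ENNReal.ofReal_natCast,
          ENNReal.ofReal_sub _ (by positivity), ENNReal.ofReal_one]
    _ ≤ _ := by gcongr

/-! ### Asymptotic optimality -/

lemma eventually_expTime_gapTime_le (S : (k : Fin K) → TestingPair (E k))
    (hac : ∀ k, (S k).MutuallyAC) (hkl : ∀ k, (S k).KLFinitePos) {m : ℕ} (hm : 1 ≤ m)
    (hmK : m < K) {A : Finset (Fin K)} (hA : A ∈ exactly K m) {e₁ e₀ ε : ℝ} (he₁ : 0 < e₁)
    (he₀ : 0 < e₀) (hD1 : ∀ k ∈ A, e₁ ≤ (S k).D1) (hD0 : ∀ k ∉ A, e₀ ≤ (S k).D0) (hε : 0 < ε) :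
    ∀ᶠ p : ℝ × ℝ in errorFilter,
      expTime S A (gapTime S m hmK (gapThreshold K m p.1 p.2))
        ≤ ENNReal.ofReal ((1 + ε) * (|Real.log (min p.1 p.2)| / (e₁ + e₀))) := by
  have hD : 0 < e₁ + e₀ := by positivity
  -- `1 + ε / 2` in front of the rate leaves a margin `ε / 2` for the terms that do not depend on it
  obtain ⟨M, hM⟩ := exists_expTime_gapTime_le S hac hkl hm hmK hA he₁ he₀ hD1 hD0
    (ρ := (1 + ε / 2)⁻¹) (by positivity) (inv_lt_one_of_one_lt₀ (by linarith))
  set κ := Real.log ((m : ℝ) * ((K : ℝ) - (m : ℝ))) with hκ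
  have hlim : Tendsto (fun p : ℝ × ℝ => ε / 2 * (|Real.log (min p.1 p.2)| / (e₁ + e₀)))
      errorFilter atTop :=
    (tendsto_abs_log_min_errorFilter.atTop_div_const hD).const_mul_atTop (by positivity)
  filter_upwards [eventually_errorFilter,
    hlim.eventually_ge_atTop (κ * (1 + ε / 2) / (e₁ + e₀) + M)] with p hp hpM
  refine (hM _ (gapThreshold_pos hm hmK hp.1.1 hp.2.1 hp.1.2)).trans
    (ENNReal.ofReal_le_ofReal ?_)
  have heq : gapThreshold K m p.1 p.2 / ((1 + ε / 2)⁻¹ * (e₁ + e₀))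
      = (1 + ε / 2) * (|Real.log (min p.1 p.2)| / (e₁ + e₀))
        + κ * (1 + ε / 2) / (e₁ + e₀) := by
    rw [gapThreshold, ← hκ]
    field_simp
  rw [heq]
  linarith

lemma tendsto_div_ofReal_one {ι : Type*} {l : Filter ι} {x : ι → ℝ≥0∞} {y : ι → ℝ}
    (hy : ∀ᶠ p in l, 0 < y p)
    (hlow : ∀ ε : ℝ, 0 < ε → ε < 1 → ∀ᶠ p in l, ENNReal.ofReal ((1 - ε) * y p) ≤ x p)
    (hupp : ∀ ε : ℝ, 0 < ε → ε < 1 → ∀ᶠ p in l, x p ≤ ENNReal.ofReal ((1 + ε) * y p)) :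
    Tendsto (fun p => x p / ENNReal.ofReal (y p)) l (𝓝 1) := by
  rw [ENNReal.tendsto_nhds ENNReal.one_ne_top]
  intro ε hε
  obtain ⟨δ, hδ0, hδ⟩ := ENNReal.lt_iff_exists_real_btwn.1 (lt_min hε (zero_lt_one' ℝ≥0∞))
  obtain ⟨hδpos, hδlt⟩ := hδ
  have hδ' : 0 < δ := ENNReal.ofReal_pos.1 hδpos
  have hδ1 : δ < 1 := ENNReal.ofReal_lt_one.1 (hδlt.trans_le (min_le_right _ _))
  have hδε : ENNReal.ofReal δ ≤ ε := hδlt.le.trans (min_le_left _ _)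
  filter_upwards [hy, hlow δ hδ' hδ1, hupp δ hδ' hδ1] with p hp hl hu
  have hp0 : ENNReal.ofReal (y p) ≠ 0 := (ENNReal.ofReal_pos.2 hp).ne'
  constructor
  · rw [ENNReal.le_div_iff_mul_le (Or.inl hp0) (Or.inl ENNReal.ofReal_ne_top)]
    refine le_trans ?_ hl
    rw [ENNReal.ofReal_mul (by linarith), ENNReal.ofReal_sub _ hδ0, ENNReal.ofReal_one]
    gcongr
  · rw [ENNReal.div_le_iff_le_mul (Or.inl hp0) (Or.inl ENNReal.ofReal_ne_top)]
    refine hu.trans ?_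
    rw [ENNReal.ofReal_mul (by linarith), ENNReal.ofReal_add zero_le_one hδ0, ENNReal.ofReal_one]
    gcongr

end SeqMultipleTesting

theorem mainTheorem2 {K : ℕ} {E : Fin K → Type*} [∀ k, MeasurableSpace (E k)]
    (S : (k : Fin K) → SeqMultipleTesting.TestingPair (E k))
    (hac : ∀ k, (S k).MutuallyAC)
    (hkl : ∀ k, (S k).KLFinitePos)
    (hsq : ∀ k, (S k).FiniteSecondMoment)
    (m : ℕ) (hm : 1 ≤ m) (hmK : m < K)
    (A : Finset (Fin K)) (hA : A ∈ SeqMultipleTesting.exactly K m) :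
    SeqMultipleTesting.AsympEquiv
      (fun α β => SeqMultipleTesting.expTime S A
        (SeqMultipleTesting.gapTime S m hmK (SeqMultipleTesting.gapThreshold K m α β)))
      (fun α β => SeqMultipleTesting.rate S A α β) ∧
    SeqMultipleTesting.AsympEquiv
      (fun α β => SeqMultipleTesting.rate S A α β)
      (fun α β => SeqMultipleTesting.infTime S A
        (SeqMultipleTesting.admissible S (SeqMultipleTesting.exactly K m) α β)) ∧
    SeqMultipleTesting.AsympEquiv
      (fun α β => SeqMultipleTesting.rate S A α β)
      (fun α β => SeqMultipleTesting.infTime S A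
        (SeqMultipleTesting.admissibleExactly S m α β)) := by
  open SeqMultipleTesting in
  obtain ⟨i, hi, hη1, hi_min⟩ := exists_eta1_eq S (nonempty_of_mem_exactly hm hA)
  obtain ⟨j, hj, hη0, hj_min⟩ := exists_eta0_eq S (compl_nonempty_of_mem_exactly hmK hA)
  have hD1 := (hkl i).2.2
  have hD0 := (hkl j).1.2
  have hD : 0 < (S i).D1 + (S j).D0 := by positivity
  set y : ℝ × ℝ → ℝ := fun p => |Real.log (min p.1 p.2)| / ((S i).D1 + (S j).D0)
  have hrate : ∀ p : ℝ × ℝ, rate S A p.1 p.2 = ENNReal.ofReal (y p) := by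
    intro p
    rw [rate, hη1, hη0, ← ENNReal.ofReal_add hD1.le hD0.le, ← ENNReal.ofReal_div_of_pos hD]
  have hy : ∀ᶠ p in errorFilter, 0 < y p :=
    (tendsto_abs_log_min_errorFilter.atTop_div_const hD).eventually_gt_atTop 0
  have hlow := fun ε h0 h1 => eventually_le_infTime S hac hkl hA hi hj (ε := ε) h0 h1
  have hupp := fun ε h0 => eventually_expTime_gapTime_le S hac hkl hm hmK hA hD1 hD0 hi_min hj_min
    (ε := ε) h0
  -- the three quantities are ordered: fewer tests have a larger infimum, and the gap rule is one
  have hinf : ∀ p : ℝ × ℝ, infTime S A (admissible S (exactly K m) p.1 p.2)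
      ≤ infTime S A (admissibleExactly S m p.1 p.2) := fun p =>
    biInf_mono (admissibleExactly_subset S m p.1 p.2)
  have hgap : ∀ᶠ p : ℝ × ℝ in errorFilter,
      infTime S A (admissibleExactly S m p.1 p.2)
        ≤ expTime S A (gapTime S m hmK (gapThreshold K m p.1 p.2)) := by
    filter_upwards [eventually_errorFilter] with p hp
    exact iInf₂_le _ (gap_mem_admissibleExactly S hac hkl hm hmK hp.1.1 hp.2.1 hp.1.2)
  have hflip : ∀ x : ℝ × ℝ → ℝ≥0∞,
      Tendsto (fun p => x p / ENNReal.ofReal (y p)) errorFilter (𝓝 1) →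
      Tendsto (fun p => ENNReal.ofReal (y p) / x p) errorFilter (𝓝 1) := by
    intro x hx
    have h := hx.inv
    rw [inv_one] at h
    refine h.congr' ?_
    filter_upwards [hy] with p hp
    exact ENNReal.inv_div (Or.inl ENNReal.ofReal_ne_top) (Or.inl (ENNReal.ofReal_pos.2 hp).ne')
  simp only [AsympEquiv, hrate]
  refine ⟨tendsto_div_ofReal_one hy (fun ε h0 h1 => ?_) fun ε h0 _ => hupp ε h0,
    hflip _ (tendsto_div_ofReal_one hy hlow fun ε h0 _ => ?_),
    hflip _ (tendsto_div_ofReal_one hy (fun ε h0 h1 => ?_) fun ε h0 _ => ?_)⟩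
  · filter_upwards [hlow ε h0 h1, hgap] with p h2 h3
    exact h2.trans ((hinf p).trans h3)
  · filter_upwards [hupp ε h0, hgap] with p h2 h3
    exact (hinf p).trans (h3.trans h2)
  · filter_upwards [hlow ε h0 h1] with p h2
    exact h2.trans (hinf p)
  · filter_upwards [hupp ε h0, hgap] with p h2 h3
    exact h3.trans h2
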